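/- Let $\Omega=\mathbb R^3\setminus\overline{B(0,1)}$ and let $-\Delta_\Omega$ be the Dirichlet Laplacian. For radial $f$ on $\Omega$ let $\mathcal F_Df(\lambda)=\sqrt{2/\pi}\int_1^\infty \frac{\sin(\lambda(r-1))}{r}f(r)\,r^2\,dr$, $\lambda>0$, be the distorted Fourier transform (extended by duality to distributions), and let $\dot H^\sigma_{D,rad}(\Omega)$ be the space of radial $f$ with $\mathcal F_Df\in L^2((0,\infty),\lambda^{2\sigma}d\lambda)$. Fix a smooth $\phi:[0,\infty)\to[0,1]$ with $\phi=1$ on $[0,1]$ and $\phi=0$ on $[2,\infty)$, and put $\mathcal F_D(P_{\le N}f)(\lambda)=\phi(\lambda/N)\,\mathcal F_Df(\lambda)$, $P_{>N}=I-P_{\le N}$. **Proposition 4.3.** There is an absolute constant $C$ such that the following holds. Let $\frac12<s\le1$, $(u_0,u_1)\in(\dot H^s_{D,rad}(\Omega)\cap L^4(\Omega))\times\dot H^{s-1}_{D,rad}(\Omega)$ and $J\in\mathbb R$. Let $w\in C(\mathbb R;\dot H^{1/2}_{D,rad}(\Omega))\cap L^4(\mathbb R\times\Omega)$ be a global solution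 (in the sense of Duhamel's formula) of $$\partial_t^2w-\Delta w+w^3=0\ \text{ in }\mathbb R\times\Omega,\qquad w|_{\partial\Omega}=0,\qquad (w,\partial_tw)|_{t=0}=(P_{>2^J}u_0,P_{>2^J}u_1).$$ Let $0<T\le\infty$ and let $v$ be a radial energy solution on $[0,T)$ of $$\partial_t^2v-\Delta v+v^3=-3v^2w-3vw^2\ \text{ in }[0,T)\times\Omega,\qquad v|_{\partial\Omega}=0,\qquad (v,\partial_tv)|_{t=0}=(P_{\le2^J}u_0,P_{\le2^J}u_1),$$ that is, $(v,\partial_tv)\in C([0,T);\dot H^1_D(\Omega)\times L^2(\Omega))$, where $\dot H^1_D(\Omega)$ is the completion of $C_c^\infty(\Omega)$ for $\|\nabla f\|_{L^2}$, and the equation holds weakly against all test functions in $C_c^\infty(\Omega)$. (In particular, $[0,T)$ may be the maximal lifespan interval of $v$.) With $$E(v)(t)=\int_\Omega\tfrac12(\partial_tv(t))^2+\tfrac12|\nabla v(t)|^2+\tfrac14|v(t)|^4\,dx,\qquad E_T=\sup_{0\le t<T}E(v)(t),$$ one has, for every $t\in[0,T)$, $$E(v)(t)\le E_T\le C\Big(E(v)(0)+E_T^{3/2}\,T^{1/2}\,\|w\|_{L^2_tL^6_x(\mathbb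 R\times\Omega)}+E_T\,\|w\|_{L^2_tL^6_x(\mathbb R\times\Omega)}^2\Big),$$ as an inequality in $[0,\infty]$ with $0\cdot\infty=0$. -/

import Mathlib

open MeasureTheory Set Filter Topology
open scoped ENNReal NNReal ContDiff

noncomputable section

namespace ExteriorNLW

/-- Three-dimensional Euclidean space. -/
abbrev E3 : Type := EuclideanSpace ℝ (Fin 3)

/-- The exterior domain: the complement in `ℝ³` of the closed unit ball. -/
def Om : Set E3 := (Metric.closedBall (0 : E3) 1)ᶜ

/-- Lebesgue measure on the exterior domain. -/
def muOm : Measure E3 := volume.restrict Om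

/-- `f` is radial on the exterior domain. -/
def IsRadial (f : E3 → ℝ) : Prop :=
  ∀ x ∈ Om, ∀ y ∈ Om, ‖x‖ = ‖y‖ → f x = f y

/-- The test functions `C_c^∞(Ω)`. -/
structure IsTest (χ : E3 → ℝ) : Prop where
  smooth : ContDiff ℝ ∞ χ
  compact : HasCompactSupport χ
  support : tsupport χ ⊆ Om

/-! ### Distorted Fourier transform of radial functions -/

/-- The generalized radial eigenfunction `e_k(x) = sin (k (|x| - 1)) / |x|`. -/
def eigenfun (k : ℝ) (x : E3) : ℝ := Real.sin (k * (‖x‖ - 1)) / ‖x‖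

/-- The distorted Fourier transform of a radial function. In polar coordinates it reads
`√(2/π) ∫_1^∞ (sin (k (r - 1)) / r) f(r) r² dr`. -/
def dft (f : E3 → ℝ) (k : ℝ) : ℝ :=
  √(2 / Real.pi) * ((4 * Real.pi)⁻¹ * ∫ x, eigenfun k x * f x ∂muOm)

/-- The function `f` on `Ω` has the distorted Fourier transform `a` (a function of the frequency
`k > 0`), in the sense of distributions: Parseval's identity
`∫_Ω f χ dx = 4π ∫_0^∞ a(k) (F_D χ)(k) dk` holds against all radial test functions. -/
def HasDFT (f : E3 → ℝ) (a : ℝ → ℝ) : Prop :=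
  ∀ χ : E3 → ℝ, IsTest χ → IsRadial χ →
    Integrable (fun x => f x * χ x) muOm ∧
    IntegrableOn (fun k => a k * dft χ k) (Ioi 0) ∧
    ∫ x, f x * χ x ∂muOm = 4 * Real.pi * ∫ k in Ioi (0 : ℝ), a k * dft χ k

/-- The square of the norm of `L²((0,∞), k^{2σ} dk)`. Up to the factor `4π` this is the square of
the norm of `Ḣ^σ_{D,rad}(Ω)`, computed on the distorted Fourier transform. -/
def hdotSq (σ : ℝ) (a : ℝ → ℝ) : ℝ≥0∞ :=
  ∫⁻ k in Ioi (0 : ℝ), ENNReal.ofReal (k ^ (2 * σ) * a k ^ 2)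

/-- `a` is the distorted Fourier transform of an element of `Ḣ^σ_{D,rad}(Ω)`. -/
def MemHdot (σ : ℝ) (a : ℝ → ℝ) : Prop :=
  AEMeasurable a (volume.restrict (Ioi (0 : ℝ))) ∧ hdotSq σ a < ⊤

/-! ### Frequency truncation of the data -/

/-- The smooth cutoff `φ : [0,∞) → [0,1]`, equal to `1` on `[0,1]` and to `0` on `[2,∞)`. -/
structure IsCutoff (φ : ℝ → ℝ) : Prop where
  smooth : ContDiffOn ℝ ∞ φ (Ici 0)
  nonneg : ∀ k, 0 ≤ k → 0 ≤ φ k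
  le_one : ∀ k, 0 ≤ k → φ k ≤ 1
  eq_one : ∀ k, 0 ≤ k → k ≤ 1 → φ k = 1
  eq_zero : ∀ k, 2 ≤ k → φ k = 0

/-- `P_{≤ N}` on the distorted Fourier side: multiplication by `φ (k / N)`. -/
def lowFreq (φ : ℝ → ℝ) (N : ℝ) (a : ℝ → ℝ) (k : ℝ) : ℝ := φ (k / N) * a k

/-- `P_{> N} = I - P_{≤ N}` on the distorted Fourier side. -/
def highFreq (φ : ℝ → ℝ) (N : ℝ) (a : ℝ → ℝ) (k : ℝ) : ℝ := a k - lowFreq φ N a k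

/-- Initial data `(u₀, u₁) ∈ (Ḣ^s_{D,rad}(Ω) ∩ L⁴(Ω)) × Ḣ^{s-1}_{D,rad}(Ω)`. Here `a₀` is the
distorted Fourier transform of `u₀`; the distribution `u₁`, which for `s < 1` need not be a
function, is given by its distorted Fourier transform `a₁`. -/
structure IsData (s : ℝ) (u₀ : E3 → ℝ) (a₀ a₁ : ℝ → ℝ) : Prop where
  radial : IsRadial u₀
  memL4 : MemLp u₀ 4 muOm
  transform : HasDFT u₀ a₀
  memHs : MemHdot s a₀
  memHs' : MemHdot (s - 1) a₁

/-! ### The high-frequency equation -/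

/-- `w ∈ C(ℝ; Ḣ^{1/2}_{D,rad}(Ω)) ∩ L⁴(ℝ × Ω)` is a global solution of
`∂_t² w - Δ w + w³ = 0` in `Ω`, `w = 0` on `∂Ω`, with `w(0)`, `∂_t w(0)` having the distorted
Fourier transforms `b₀`, `b₁`: it satisfies Duhamel's formula
`w(t) = cos(t√(-Δ_Ω)) w₀ + sin(t√(-Δ_Ω))/√(-Δ_Ω) w₁ - ∫_0^t sin((t-τ)√(-Δ_Ω))/√(-Δ_Ω) w(τ)³ dτ`,
written on the distorted Fourier side. The elements of `Ḣ^{1/2}_D(Ω)` are functions in `L³(Ω)`,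
so that `w(τ)³` is integrable and its transform is given by the integral. -/
structure IsGlobalSolution (b₀ b₁ : ℝ → ℝ) (w : ℝ → E3 → ℝ) : Prop where
  measurable : Measurable (Function.uncurry w)
  radial : ∀ t, IsRadial (w t)
  memL3 : ∀ t, MemLp (w t) 3 muOm
  memL4 : MemLp (Function.uncurry w) 4 ((volume : Measure ℝ).prod muOm)
  duhamel : ∃ W : ℝ → ℝ → ℝ,
    (∀ t, HasDFT (w t) (W t)) ∧
    (∀ t, MemHdot (1 / 2) (W t)) ∧
    (∀ t₀, Tendsto (fun t => hdotSq (1 / 2) (fun k => W t k - W t₀ k)) (𝓝 t₀) (𝓝 0)) ∧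
    ∀ t, ∀ᵐ k ∂(volume.restrict (Ioi (0 : ℝ))),
      W t k = Real.cos (t * k) * b₀ k + Real.sin (t * k) / k * b₁ k
        - ∫ τ in (0 : ℝ)..t, Real.sin ((t - τ) * k) / k * dft (fun x => w τ x ^ 3) k

/-- The mixed norm `‖w‖_{L²_t L⁶_x(ℝ × Ω)}`. -/
def normL2L6 (w : ℝ → E3 → ℝ) : ℝ≥0∞ :=
  (∫⁻ t : ℝ, eLpNorm (w t) 6 muOm ^ (2 : ℝ)) ^ (1 / 2 : ℝ)

/-! ### The difference equation -/

/-- `f ∈ Ḣ¹_D(Ω)`, the completion of `C_c^∞(Ω)` for the norm `‖∇f‖_{L²(Ω)}` (realized as a space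
of functions in `L⁶(Ω)`), and `G` is the gradient of `f`. -/
def MemH1D (f : E3 → ℝ) (G : E3 → E3) : Prop :=
  ∃ χ : ℕ → E3 → ℝ, (∀ n, IsTest (χ n)) ∧
    Tendsto (fun n => eLpNorm (fun x => χ n x - f x) 6 muOm) atTop (𝓝 0) ∧
    Tendsto (fun n => eLpNorm (fun x => gradient (χ n) x - G x) 2 muOm) atTop (𝓝 0)

/-- The time interval `[0, T)`, where `0 < T ≤ ∞`. -/
def timeInterval (T : ℝ≥0∞) : Set ℝ := {t | 0 ≤ t ∧ ENNReal.ofReal t < T}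

/-- `v` is an energy solution on `[0,T)` of
`∂_t² v - Δ v + v³ = -3 v² w - 3 v w²` in `Ω`, `v = 0` on `∂Ω`,
with `v(0)`, `∂_t v(0)` having the distorted Fourier transforms `c₀`, `c₁`:
`v ∈ C([0,T); Ḣ¹_{D,rad}(Ω))`, `∂_t v ∈ C([0,T); L²(Ω))`, and the equation holds weakly.
Here `vt = ∂_t v` and `gv = ∇v`. The boundary condition is part of `v(t) ∈ Ḣ¹_D(Ω)`. -/
structure IsEnergySolution (c₀ c₁ : ℝ → ℝ) (w : ℝ → E3 → ℝ) (T : ℝ≥0∞)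
    (v vt : ℝ → E3 → ℝ) (gv : ℝ → E3 → E3) : Prop where
  pos : 0 < T
  measurable_v : Measurable (Function.uncurry v)
  measurable_vt : Measurable (Function.uncurry vt)
  measurable_gv : Measurable (Function.uncurry gv)
  radial : ∀ t ∈ timeInterval T, IsRadial (v t)
  memH1 : ∀ t ∈ timeInterval T, MemH1D (v t) (gv t)
  memL2 : ∀ t ∈ timeInterval T, MemLp (vt t) 2 muOm
  continuous_H1 : ∀ t₀ ∈ timeInterval T,
    Tendsto (fun t => eLpNorm (fun x => gv t x - gv t₀ x) 2 muOm) (𝓝[timeInterval T] t₀) (𝓝 0)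
  continuous_L2 : ∀ t₀ ∈ timeInterval T,
    Tendsto (fun t => eLpNorm (fun x => vt t x - vt t₀ x) 2 muOm) (𝓝[timeInterval T] t₀) (𝓝 0)
  time_deriv : ∀ t₀ ∈ timeInterval T,
    Tendsto (fun t => eLpNorm (fun x => (v t x - v t₀ x) / (t - t₀) - vt t₀ x) 2 muOm)
      (𝓝[timeInterval T \ {t₀}] t₀) (𝓝 0)
  init : HasDFT (v 0) c₀
  init' : HasDFT (vt 0) c₁
  weak_eq : ∀ χ : E3 → ℝ, IsTest χ → ∀ t ∈ timeInterval T,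
    ∫ x, vt t x * χ x ∂muOm - ∫ x, vt 0 x * χ x ∂muOm =
      ∫ τ in (0 : ℝ)..t,
        (-(∫ x, inner ℝ (gv τ x) (gradient χ x) ∂muOm)
          + ∫ x, (-(v τ x ^ 3) - 3 * v τ x ^ 2 * w τ x - 3 * v τ x * w τ x ^ 2) * χ x ∂muOm)

/-- The energy `E(v)(t) = ∫_Ω ½ (∂_t v)² + ½ |∇v|² + ¼ v⁴ dx`, with values in `[0,∞]`. -/
def energy (v vt : ℝ → E3 → ℝ) (gv : ℝ → E3 → E3) (t : ℝ) : ℝ≥0∞ :=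
  ∫⁻ x, ENNReal.ofReal (1 / 2 * vt t x ^ 2 + 1 / 2 * ‖gv t x‖ ^ 2 + 1 / 4 * v t x ^ 4) ∂muOm

/-- `E_T = sup_{0 ≤ t < T} E(v)(t)`. -/
def energySup (T : ℝ≥0∞) (v vt : ℝ → E3 → ℝ) (gv : ℝ → E3 → E3) : ℝ≥0∞ :=
  ⨆ t ∈ timeInterval T, energy v vt gv t

end ExteriorNLW

end

/-! Formally, pairing the equation with `∂_t v` gives `dE/dt = ∫ ∂_t v (-3v²w - 3vw²)`. Hölder with
three factors in `L⁶` and the Sobolev embedding of `Ḣ¹_D(Ω)` in `L⁶` bound the right side by `‖∂_t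
v‖₂ (3S²‖∇v‖₂²‖w‖₆ + 3S‖∇v‖₂‖w‖₆²)`, with `S` the Sobolev constant, hence by multiples of
`E_T^{3/2}‖w‖₆` and `E_T‖w‖₆²`. Integrating in time, with Cauchy–Schwarz on the first term, gives
the estimate.

The obstacle is that `∂_t v(t)` is only in `L²`, so it is not an admissible test function. The
increment `v(t) - v(s) = ∫_s^t ∂_t v` is: it lies in `Ḣ¹_D ∩ L²`, where test functions are dense in
the inhomogeneous norm (`MemH1D.exists_test_lt`). So the weak equation integrated over `[s, t]` can
be tested with the increment of `v` over the same interval (`IsEnergySolution.increment`). With `t =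
s + h`, this is `h²` times the derivative of the kinetic and gradient energies of the averages over
`[s, s + h]`, plus the cubic term and an error controlled by the forcing. Letting `h → 0` yields the
energy inequality (`energy_estimate_of_increments`).

The cubic term `∫⟨v³, ∂_t v⟩` must still be recognized as the variation of `¼∫v⁴`. This uses
convexity of `a⁴/4`: the tangent line inequality gives the chain rule without any continuity in `L⁴`
(`sub_eq_integral_of_subgradient`), and it also carries membership in `L⁴` from time `0` to later
times.

The result on compact time intervals is `IsEnergySolution.energy_le`; what remains is the choice of
constants and the cases where a quantity is `0` or `∞`. -/

noncomputable section

namespace ExteriorNLW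

/-! ### Energy estimate for abstract wave equations in Hilbert space, by forward averaging in time.
-/

section Abstract

variable {H K : Type*} [NormedAddCommGroup H] [InnerProductSpace ℝ H]
  [NormedAddCommGroup K] [InnerProductSpace ℝ K]

/-- The Steklov average of `Y` over `[t, t + h]`. -/
def steklov (h : ℝ) (Y : ℝ → H) (t : ℝ) : H := h⁻¹ • ∫ τ in t..(t + h), Y τ

theorem integral_shift_eq {Y : ℝ → H} (hY : Continuous Y) (h t : ℝ) :
    ∫ τ in t..(t + h), Y τ = (∫ τ in (0 : ℝ)..(t + h), Y τ) - ∫ τ in (0 : ℝ)..t, Y τ :=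
  (intervalIntegral.integral_interval_sub_left (hY.intervalIntegrable _ _)
    (hY.intervalIntegrable _ _)).symm

theorem hasDerivAt_steklov [CompleteSpace H] {Y : ℝ → H} (hY : Continuous Y) (h t : ℝ) :
    HasDerivAt (steklov h Y) (h⁻¹ • (Y (t + h) - Y t)) t := by
  have h1 : HasDerivAt (fun t => ∫ τ in (0 : ℝ)..t, Y τ) (Y t) t :=
    intervalIntegral.integral_hasDerivAt_right (hY.intervalIntegrable _ _)
      (hY.stronglyMeasurableAtFilter _ _) hY.continuousAt
  have h2 : HasDerivAt (fun t => ∫ τ in (0 : ℝ)..(t + h), Y τ) (Y (t + h)) t :=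
    (intervalIntegral.integral_hasDerivAt_right (hY.intervalIntegrable 0 (t + h))
      (hY.stronglyMeasurableAtFilter _ _) hY.continuousAt).comp_add_const t h
  have h3 := (h2.sub h1).const_smul h⁻¹
  refine h3.congr_of_eventuallyEq (Eventually.of_forall fun s => ?_)
  simp only [steklov, integral_shift_eq hY h s, Pi.smul_apply, Pi.sub_apply]

theorem continuous_steklov [CompleteSpace H] {Y : ℝ → H} (hY : Continuous Y) (h : ℝ) : Continuous (steklov h Y) :=
  continuous_iff_continuousAt.2 fun t => (hasDerivAt_steklov hY h t).continuousAt

theorem tendsto_steklov [CompleteSpace H] {Y : ℝ → H} (hY : Continuous Y) (t : ℝ) :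
    Tendsto (fun h => steklov h Y t) (𝓝[>] 0) (𝓝 (Y t)) := by
  have h1 : HasDerivAt (fun s => ∫ τ in t..s, Y τ) (Y t) t :=
    intervalIntegral.integral_hasDerivAt_right (hY.intervalIntegrable _ _)
      (hY.stronglyMeasurableAtFilter _ _) hY.continuousAt
  have h2 := h1.tendsto_slope_zero
  simp only [intervalIntegral.integral_same, sub_zero] at h2
  exact h2.mono_left (nhdsWithin_mono _ fun x hx => (ne_of_gt hx))

theorem tendsto_norm_steklov_sq [CompleteSpace H] {Y : ℝ → H} (hY : Continuous Y) (t : ℝ) :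
    Tendsto (fun h => ‖steklov h Y t‖ ^ 2 / 2) (𝓝[>] 0) (𝓝 (‖Y t‖ ^ 2 / 2)) :=
  ((tendsto_steklov hY t).norm.pow 2).div_const 2

theorem norm_steklov_le {Y : ℝ → H} {h t M : ℝ} (hh : 0 < h)
    (hM : ∀ τ ∈ Icc t (t + h), ‖Y τ‖ ≤ M) : ‖steklov h Y t‖ ≤ M := by
  have h1 : ‖∫ τ in t..(t + h), Y τ‖ ≤ M * |t + h - t| :=
    intervalIntegral.norm_integral_le_of_norm_le_const fun τ hτ => by
      rw [uIoc_of_le (by linarith)] at hτ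
      exact hM τ ⟨hτ.1.le, hτ.2⟩
  rw [add_sub_cancel_left, abs_of_pos hh] at h1
  rw [steklov, norm_smul, norm_inv, Real.norm_of_nonneg hh.le, inv_mul_le_iff₀ hh]
  linarith

/-- Each `σ` lies in windows `[τ, τ + h]` only for a set of `τ` of length at most `h`. Working with
the monotone primitive `G` of `g` replaces Fubini by a translation: the left side is `∫_t^{t+h} G -
∫_0^h G`. -/
theorem integral_average_le {g : ℝ → ℝ} (hg : ∀ a b, IntervalIntegrable g volume a b)
    (hg0 : ∀ t, 0 ≤ g t) {t h b : ℝ} (hh : 0 < h) (hb : t + h ≤ b) :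
    ∫ τ in (0 : ℝ)..t, (∫ σ in τ..(τ + h), g σ) ≤ h * ∫ σ in (0 : ℝ)..b, g σ := by
  have hGc : Continuous fun t => ∫ σ in (0 : ℝ)..t, g σ :=
    intervalIntegral.continuous_primitive (fun a b => hg a b) 0
  set G : ℝ → ℝ := fun t => ∫ σ in (0 : ℝ)..t, g σ with hG
  have hGm : Monotone G := fun x y hxy => by
    have : G y - G x = ∫ σ in x..y, g σ :=
      intervalIntegral.integral_interval_sub_left (hg _ _) (hg _ _)
    have h0 := intervalIntegral.integral_nonneg (f := g) (μ := volume) hxy (fun u _ => hg0 u)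
    linarith
  have e1 : ∀ τ, ∫ σ in τ..(τ + h), g σ = G (τ + h) - G τ := fun τ =>
    (intervalIntegral.integral_interval_sub_left (hg _ _) (hg _ _)).symm
  simp_rw [e1]
  have hGi : ∀ a b, IntervalIntegrable G volume a b := fun a b => hGc.intervalIntegrable a b
  have hsi : IntervalIntegrable (fun τ => G (τ + h)) volume 0 t :=
    (hGc.comp (continuous_id.add continuous_const)).intervalIntegrable _ _
  rw [intervalIntegral.integral_sub hsi (hGi _ _), intervalIntegral.integral_comp_add_right,
    zero_add]
  have e2 : (∫ x in h..(t + h), G x) - ∫ x in (0 : ℝ)..t, G x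
      = (∫ x in t..(t + h), G x) - ∫ x in (0 : ℝ)..h, G x := by
    have a1 := intervalIntegral.integral_add_adjacent_intervals (hGi 0 h) (hGi h (t + h))
    have a2 := intervalIntegral.integral_add_adjacent_intervals (hGi 0 t) (hGi t (t + h))
    linarith
  have hG0 : G 0 = 0 := by simp [hG]
  have p1 : 0 ≤ ∫ x in (0 : ℝ)..h, G x :=
    intervalIntegral.integral_nonneg hh.le fun u hu => hG0 ▸ hGm hu.1
  have p2 : ∫ x in t..(t + h), G x ≤ ∫ _ in t..(t + h), G b :=
    intervalIntegral.integral_mono_on (by linarith) (hGi _ _) (by simp)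
      fun x hx => hGm (hx.2.trans hb)
  rw [intervalIntegral.integral_const, add_sub_cancel_left, smul_eq_mul] at p2
  linarith

/-- The energy estimate for the Steklov averages of a solution of an abstract wave equation
`Y' + A Z + U = F`, given in the form of its increments over `[s, t]` tested with the increments
of the solution. -/
theorem steklov_energy_estimate [CompleteSpace H] [CompleteSpace K]
    {Y U : ℝ → H} {Z : ℝ → K} {g : ℝ → ℝ} {b M h : ℝ}
    (hY : Continuous Y) (hU : Continuous U) (hZ : Continuous Z)
    (hg : ∀ a b, IntervalIntegrable g volume a b) (hg0 : ∀ t, 0 ≤ g t)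
    (hM : ∀ t ∈ Icc 0 b, ‖Y t‖ ≤ M)
    (hinc : ∀ s t, 0 ≤ s → s < t → t ≤ b →
      |inner ℝ (Y t - Y s) (∫ τ in s..t, Y τ) + inner ℝ (∫ τ in s..t, Z τ) (Z t - Z s)
        + inner ℝ (∫ τ in s..t, U τ) (∫ τ in s..t, Y τ)|
        ≤ ‖∫ τ in s..t, Y τ‖ * ∫ τ in s..t, g τ)
    {t : ℝ} (ht : 0 ≤ t) (hh : 0 < h) (hhb : h < b - t) :
    |(‖steklov h Y t‖ ^ 2 / 2 + ‖steklov h Z t‖ ^ 2 / 2)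
      - (‖steklov h Y 0‖ ^ 2 / 2 + ‖steklov h Z 0‖ ^ 2 / 2)
      + ∫ τ in (0 : ℝ)..t, inner ℝ (steklov h U τ) (steklov h Y τ)|
      ≤ M * ∫ τ in (0 : ℝ)..b, g τ := by
  have hM0 : 0 ≤ M := (norm_nonneg _).trans (hM 0 ⟨le_rfl, by linarith⟩)
  have hcP := continuous_steklov hY h
  have hcR := continuous_steklov hU h
  have hcI : Continuous fun τ => inner ℝ (steklov h U τ) (steklov h Y τ) := hcR.inner hcP
  set Φ : ℝ → ℝ := fun t => (‖steklov h Y t‖ ^ 2 / 2 + ‖steklov h Z t‖ ^ 2 / 2)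
      - (‖steklov h Y 0‖ ^ 2 / 2 + ‖steklov h Z 0‖ ^ 2 / 2)
      + ∫ τ in (0 : ℝ)..t, inner ℝ (steklov h U τ) (steklov h Y τ) with hΦ
  set Φ' : ℝ → ℝ := fun t => inner ℝ (steklov h Y t) (h⁻¹ • (Y (t + h) - Y t))
      + inner ℝ (steklov h Z t) (h⁻¹ • (Z (t + h) - Z t))
      + inner ℝ (steklov h U t) (steklov h Y t) with hΦ'
  have hder : ∀ τ, HasDerivAt Φ (Φ' τ) τ := fun τ => by
    have d1 := ((hasDerivAt_steklov hY h τ).norm_sq).div_const 2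
    have d2 := ((hasDerivAt_steklov hZ h τ).norm_sq).div_const 2
    have d3 : HasDerivAt (fun t => ∫ τ in (0 : ℝ)..t, inner ℝ (steklov h U τ) (steklov h Y τ))
        (inner ℝ (steklov h U τ) (steklov h Y τ)) τ :=
      intervalIntegral.integral_hasDerivAt_right (hcI.intervalIntegrable _ _)
        (hcI.stronglyMeasurableAtFilter _ _) hcI.continuousAt
    have d := ((d1.add d2).sub_const
      (‖steklov h Y 0‖ ^ 2 / 2 + ‖steklov h Z 0‖ ^ 2 / 2)).add d3
    refine d.congr_deriv ?_
    simp only [hΦ']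
    ring
  have hGc : Continuous fun t => ∫ σ in (0 : ℝ)..t, g σ :=
    intervalIntegral.continuous_primitive (fun a b => hg a b) 0
  -- Although `g` is merely integrable, its window integral is continuous, so the primitive of `B'`
  -- is differentiable everywhere and can serve as the comparison function.
  set B' : ℝ → ℝ := fun τ => M * h⁻¹ * ∫ σ in τ..(τ + h), g σ with hB'
  have hB'c : Continuous B' := by
    have : B' = fun τ => M * h⁻¹ *
        ((∫ σ in (0 : ℝ)..(τ + h), g σ) - ∫ σ in (0 : ℝ)..τ, g σ) := by
      funext τ
      simp only [hB']
      rw [intervalIntegral.integral_interval_sub_left (hg _ _) (hg _ _)]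
    rw [this]
    exact continuous_const.mul
      ((hGc.comp (continuous_id.add continuous_const)).sub hGc)
  have hB : ∀ τ, HasDerivAt (fun t => ∫ τ in (0 : ℝ)..t, B' τ) (B' τ) τ := fun τ =>
    intervalIntegral.integral_hasDerivAt_right (hB'c.intervalIntegrable _ _)
      (hB'c.stronglyMeasurableAtFilter _ _) hB'c.continuousAt
  have hbound : ∀ τ ∈ Ico 0 t, ‖Φ' τ‖ ≤ B' τ := by
    intro τ hτ
    have hi := hinc τ (τ + h) hτ.1 (by linarith) (by linarith [hτ.2])
    -- Both entries of each inner product carry a factor `h⁻¹`, so `Φ'` is the form in `hinc`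
    -- divided by `h²`. One factor is absorbed by `‖∫ Y‖ ≤ h M`, the other by `integral_average_le`.
    have e : Φ' τ = h⁻¹ * h⁻¹ *
        (inner ℝ (Y (τ + h) - Y τ) (∫ σ in τ..(τ + h), Y σ)
        + inner ℝ (∫ σ in τ..(τ + h), Z σ) (Z (τ + h) - Z τ)
        + inner ℝ (∫ σ in τ..(τ + h), U σ) (∫ σ in τ..(τ + h), Y σ)) := by
      simp only [hΦ', steklov, real_inner_smul_left, real_inner_smul_right]
      rw [real_inner_comm (Y (τ + h) - Y τ)]
      ring
    have hn : ‖steklov h Y τ‖ ≤ M := norm_steklov_le hh fun σ hσ =>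
      hM σ ⟨hτ.1.trans hσ.1, by linarith [hτ.2, hσ.2]⟩
    have hn' : ‖∫ σ in τ..(τ + h), Y σ‖ ≤ h * M := by
      rwa [steklov, norm_smul, norm_inv, Real.norm_of_nonneg hh.le, inv_mul_le_iff₀ hh] at hn
    have hg1 : 0 ≤ ∫ σ in τ..(τ + h), g σ :=
      intervalIntegral.integral_nonneg (by linarith) fun u _ => hg0 u
    have hii : 0 < h⁻¹ := inv_pos.2 hh
    rw [e, Real.norm_eq_abs, abs_mul, abs_of_pos (mul_pos hii hii)]
    calc _ ≤ h⁻¹ * h⁻¹ * ((h * M) * ∫ σ in τ..(τ + h), g σ) := by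
          gcongr
          exact hi.trans (by gcongr)
      _ = B' τ := by simp only [hB']; field_simp
  have hfin := image_norm_le_of_norm_deriv_right_le_deriv_boundary (f := Φ) (f' := Φ') (a := 0)
    (b := t) (B := fun t => ∫ τ in (0 : ℝ)..t, B' τ) (B' := B')
    (fun τ _ => (hder τ).continuousAt.continuousWithinAt)
    (fun τ _ => (hder τ).hasDerivWithinAt) (by simp [hΦ]) hB hbound (x := t) ⟨ht, le_rfl⟩
  refine (Real.norm_eq_abs _ ▸ hfin).trans ?_
  have := integral_average_le hg hg0 hh (by linarith : t + h ≤ b)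
  simp only [hB']
  rw [intervalIntegral.integral_const_mul]
  calc _ ≤ M * h⁻¹ * (h * ∫ σ in (0 : ℝ)..b, g σ) := by gcongr
    _ = _ := by field_simp

/-- The energy estimate for an abstract wave equation `Y' + A Z + U = F`, given in the form
of its increments over `[s, t]` tested with the increments of the solution. -/
theorem energy_estimate_of_increments [CompleteSpace H] [CompleteSpace K]
    {Y U : ℝ → H} {Z : ℝ → K} {g : ℝ → ℝ} {b M : ℝ}
    (hY : Continuous Y) (hU : Continuous U) (hZ : Continuous Z)
    (hg : ∀ a b, IntervalIntegrable g volume a b) (hg0 : ∀ t, 0 ≤ g t)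
    (hM : ∀ t ∈ Icc 0 b, ‖Y t‖ ≤ M)
    (hinc : ∀ s t, 0 ≤ s → s < t → t ≤ b →
      |inner ℝ (Y t - Y s) (∫ τ in s..t, Y τ) + inner ℝ (∫ τ in s..t, Z τ) (Z t - Z s)
        + inner ℝ (∫ τ in s..t, U τ) (∫ τ in s..t, Y τ)|
        ≤ ‖∫ τ in s..t, Y τ‖ * ∫ τ in s..t, g τ)
    {t : ℝ} (ht : 0 ≤ t) (htb : t < b) :
    |(‖Y t‖ ^ 2 / 2 + ‖Z t‖ ^ 2 / 2) - (‖Y 0‖ ^ 2 / 2 + ‖Z 0‖ ^ 2 / 2)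
      + ∫ τ in (0 : ℝ)..t, inner ℝ (U τ) (Y τ)| ≤ M * ∫ τ in (0 : ℝ)..b, g τ := by
  have key : ∀ᶠ h in 𝓝[>] (0 : ℝ),
      |(‖steklov h Y t‖ ^ 2 / 2 + ‖steklov h Z t‖ ^ 2 / 2)
        - (‖steklov h Y 0‖ ^ 2 / 2 + ‖steklov h Z 0‖ ^ 2 / 2)
        + ∫ τ in (0 : ℝ)..t, inner ℝ (steklov h U τ) (steklov h Y τ)|
        ≤ M * ∫ τ in (0 : ℝ)..b, g τ := by
    -- The averages look forward in time; `t < b` keeps every window starting in `[0, t]` inside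
    -- `[0, b]`.
    have hlt : ∀ᶠ h in 𝓝[>] (0 : ℝ), h < b - t :=
      nhdsWithin_le_nhds (Iio_mem_nhds (by linarith))
    filter_upwards [hlt, self_mem_nhdsWithin] with h hhb hh
    exact steklov_energy_estimate hY hU hZ hg hg0 hM hinc ht hh hhb
  obtain ⟨C, hC⟩ := (isCompact_Icc (a := (0 : ℝ)) (b := b)).exists_bound_of_continuousOn
    hU.continuousOn
  have hC0 : 0 ≤ C := (norm_nonneg _).trans (hC 0 ⟨le_rfl, ht.trans htb.le⟩)
  have hlim : Tendsto (fun h => ∫ τ in (0 : ℝ)..t, inner ℝ (steklov h U τ) (steklov h Y τ))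
      (𝓝[>] 0) (𝓝 (∫ τ in (0 : ℝ)..t, inner ℝ (U τ) (Y τ))) := by
    refine intervalIntegral.tendsto_integral_filter_of_dominated_convergence (fun _ => C * M)
      (Eventually.of_forall fun h =>
        ((continuous_steklov hU h).inner (continuous_steklov hY h)).aestronglyMeasurable) ?_
      (by simp) (Eventually.of_forall fun τ _ =>
        (tendsto_steklov hU τ).inner (tendsto_steklov hY τ))
    have hlt : ∀ᶠ h in 𝓝[>] (0 : ℝ), h < b - t :=
      nhdsWithin_le_nhds (Iio_mem_nhds (by linarith))
    filter_upwards [hlt, self_mem_nhdsWithin] with h hhb hh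
    refine Eventually.of_forall fun τ hτ => ?_
    rw [uIoc_of_le ht] at hτ
    have hsub : ∀ σ ∈ Icc τ (τ + h), σ ∈ Icc 0 b := fun σ hσ =>
      ⟨hτ.1.le.trans hσ.1, by linarith [hτ.2, hσ.2]⟩
    refine (norm_inner_le_norm _ _).trans ?_
    exact mul_le_mul (norm_steklov_le hh fun σ hσ => hC σ (hsub σ hσ))
      (norm_steklov_le hh fun σ hσ => hM σ (hsub σ hσ)) (norm_nonneg _) hC0
  refine le_of_tendsto ?_ key
  have hq := tendsto_norm_steklov_sq hY
  have hr := tendsto_norm_steklov_sq hZ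
  exact ((((hq t).add (hr t)).sub ((hq 0).add (hr 0))).add hlim).abs

/-- The chain rule for a potential `ψ` with monotone subgradient `U` along a curve `X`. -/
theorem sub_eq_integral_of_subgradient {X Y U : ℝ → H} {ψ : ℝ → ℝ} {a b : ℝ} (hab : a ≤ b)
    (hX : ∀ t ∈ Icc a b, HasDerivWithinAt X (Y t) (Icc a b) t)
    (hY : Continuous Y) (hU : Continuous U)
    (hψ : ∀ s ∈ Icc a b, ∀ t ∈ Icc a b, inner ℝ (U s) (X t - X s) ≤ ψ t - ψ s) :
    ∫ τ in a..b, inner ℝ (U τ) (Y τ) = ψ b - ψ a := by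
  -- The subgradient inequality at `s` and at `t` gives `0 ≤ ψ t - ψ s - ⟨U s, X t - X s⟩ ≤ ⟨U t - U
  -- s, X t - X s⟩`. The upper bound is `o(t - s)`, since `U` is continuous and `X` is
  -- differentiable at `s`.
  have hder : ∀ s ∈ Icc a b, HasDerivWithinAt ψ (inner ℝ (U s) (Y s)) (Icc a b) s := by
    intro s hs
    have h1 := ((innerSL ℝ (U s)).hasFDerivAt.comp_hasDerivWithinAt s (hX s hs))
    rw [hasDerivWithinAt_iff_isLittleO] at h1 ⊢
    have hUo : (fun t => U t - U s) =o[𝓝[Icc a b] s] (fun _ => (1 : ℝ)) := by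
      rw [Asymptotics.isLittleO_one_iff]
      have := (hU.tendsto s).sub_const (U s)
      rw [sub_self] at this
      exact this.mono_left nhdsWithin_le_nhds
    have hXO : (fun t => X t - X s) =O[𝓝[Icc a b] s] fun t => t - s :=
      (hX s hs).differentiableWithinAt.isBigO_sub
    have h2 : (fun t => inner ℝ (U t - U s) (X t - X s)) =o[𝓝[Icc a b] s] fun t => t - s := by
      have hb : (fun t => inner ℝ (U t - U s) (X t - X s)) =O[𝓝[Icc a b] s]
          fun t => ‖U t - U s‖ * ‖X t - X s‖ :=
        Asymptotics.IsBigO.of_bound 1 (Eventually.of_forall fun t => by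
          rw [one_mul, norm_mul, norm_norm, norm_norm]
          exact norm_inner_le_norm _ _)
      have := hUo.norm_left.mul_isBigO hXO.norm_left
      simp only [one_mul] at this
      exact hb.trans_isLittleO this
    have h3 : (fun t => (ψ t - ψ s) - inner ℝ (U s) (X t - X s)) =o[𝓝[Icc a b] s]
        fun t => t - s := by
      refine Asymptotics.IsBigO.trans_isLittleO (Asymptotics.IsBigO.of_bound 1 ?_) h2
      filter_upwards [self_mem_nhdsWithin] with t ht
      have i1 := hψ s hs t ht
      have i2 := hψ t ht s hs
      have e1 : inner ℝ (U t) (X s - X t) = - inner ℝ (U t) (X t - X s) := by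
        rw [← inner_neg_right, neg_sub]
      rw [one_mul, Real.norm_eq_abs, Real.norm_eq_abs, inner_sub_left,
        abs_of_nonneg (by linarith)]
      exact (by linarith : _ ≤ _).trans (le_abs_self _)
    refine (h3.add h1).congr_left fun t => ?_
    simp [inner_sub_right]
  refine intervalIntegral.integral_eq_sub_of_hasDeriv_right_of_le hab
    (fun s hs => (hder s hs).continuousWithinAt) (fun s hs => ?_)
    ((hU.inner hY).intervalIntegrable _ _)
  exact ((hder s (Ioo_subset_Icc_self hs)).hasDerivAt
    (Icc_mem_nhds hs.1 hs.2)).hasDerivWithinAt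

theorem integral_eq_sub_of_hasDerivWithinAt_Icc [CompleteSpace H] {X Y : ℝ → H} {a b s t : ℝ}
    (hX : ∀ t ∈ Icc a b, HasDerivWithinAt X (Y t) (Icc a b) t) (hY : Continuous Y)
    (has : a ≤ s) (hst : s ≤ t) (htb : t ≤ b) :
    ∫ τ in s..t, Y τ = X t - X s :=
  intervalIntegral.integral_eq_sub_of_hasDeriv_right_of_le hst
    (fun r hr => ((hX r ⟨has.trans hr.1, hr.2.trans htb⟩).mono
      (Icc_subset_Icc has htb)).continuousWithinAt)
    (fun r hr => ((hX r ⟨has.trans hr.1.le, hr.2.le.trans htb⟩).hasDerivAt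
      (Icc_mem_nhds (has.trans_lt hr.1) (hr.2.trans_le htb))).hasDerivWithinAt)
    (hY.intervalIntegrable _ _)

end Abstract

/-! ### Hölder inequalities for products of three functions, and dominated convergence in `L²`. -/

section Holder

variable {α : Type*} {mα : MeasurableSpace α} {μ : Measure α}

theorem holderTriple_six_three_two : ENNReal.HolderTriple 6 3 2 := by
  constructor
  rw [← ENNReal.toReal_eq_toReal_iff' (by simp) (by simp), ENNReal.toReal_add (by simp) (by simp)]
  norm_num

theorem holderTriple_six_six_three : ENNReal.HolderTriple 6 6 3 := by
  constructor
  rw [← ENNReal.toReal_eq_toReal_iff' (by simp) (by simp), ENNReal.toReal_add (by simp) (by simp)]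
  norm_num

theorem eLpNorm_fun_smul_le {F : Type*} [NormedAddCommGroup F] [NormedSpace ℝ F]
    {p q r : ℝ≥0∞} [ENNReal.HolderTriple p q r] {φ : α → ℝ} {f : α → F}
    (hφ : AEStronglyMeasurable φ μ) (hf : AEStronglyMeasurable f μ) :
    eLpNorm (fun x => φ x • f x) r μ ≤ eLpNorm φ p μ * eLpNorm f q μ :=
  eLpNorm_smul_le_mul_eLpNorm hf hφ

theorem eLpNorm_mul_mul_le {f g h : α → ℝ} (hf : AEStronglyMeasurable f μ)
    (hg : AEStronglyMeasurable g μ) (hh : AEStronglyMeasurable h μ) :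
    eLpNorm (fun x => f x * (g x * h x)) 2 μ
      ≤ eLpNorm f 6 μ * (eLpNorm g 6 μ * eLpNorm h 6 μ) := by
  have i1 := holderTriple_six_three_two
  have i2 := holderTriple_six_six_three
  have hgh : AEStronglyMeasurable (fun x => g x • h x) μ := hg.smul hh
  have h1 : eLpNorm (fun x => f x • (g x • h x)) 2 μ
      ≤ eLpNorm f 6 μ * eLpNorm (fun x => g x • h x) 3 μ := eLpNorm_fun_smul_le hf hgh
  have h2 : eLpNorm (fun x => g x • h x) 3 μ ≤ eLpNorm g 6 μ * eLpNorm h 6 μ :=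
    eLpNorm_fun_smul_le hg hh
  simp only [smul_eq_mul] at h1 h2
  exact h1.trans (by gcongr)

theorem memLp_mul_mul {f g h : α → ℝ} (hf : MemLp f 6 μ) (hg : MemLp g 6 μ) (hh : MemLp h 6 μ) :
    MemLp (fun x => f x * (g x * h x)) 2 μ :=
  ⟨hf.1.mul (hg.1.mul hh.1), (eLpNorm_mul_mul_le hf.1 hg.1 hh.1).trans_lt
    (ENNReal.mul_lt_top hf.2 (ENNReal.mul_lt_top hg.2 hh.2))⟩

theorem tendsto_eLpNorm_two_zero_of_dominated {F : Type*} [NormedAddCommGroup F]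
    {f : ℕ → α → F} {G : α → F} (hf : ∀ n, AEStronglyMeasurable (f n) μ) (hG : MemLp G 2 μ)
    (hle : ∀ n x, ‖f n x‖ ≤ ‖G x‖) (hlim : ∀ x, Tendsto (fun n => f n x) atTop (𝓝 0)) :
    Tendsto (fun n => eLpNorm (f n) 2 μ) atTop (𝓝 0) := by
  have h1 : Tendsto (fun n => ∫⁻ x, ‖f n x‖ₑ ^ (2 : ℝ) ∂μ) atTop (𝓝 (∫⁻ _, 0 ∂μ)) := by
    refine tendsto_lintegral_of_dominated_convergence' (fun x => ‖G x‖ₑ ^ (2 : ℝ))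
      (fun n => (hf n).enorm.pow_const _)
      (fun n => Eventually.of_forall fun x => ?_) ?_ (Eventually.of_forall fun x => ?_)
    · exact ENNReal.rpow_le_rpow (enorm_le_iff_norm_le.2 (hle n x)) (by norm_num)
    · have := lintegral_rpow_enorm_lt_top_of_eLpNorm_lt_top (by simp) (by simp) hG.2
      simpa using this.ne
    · have := (hlim x).enorm.ennrpow_const 2
      simpa using this
  have h2 := h1.ennrpow_const (1 / 2)
  simp only [lintegral_const, zero_mul] at h2
  rw [ENNReal.zero_rpow_of_pos (by norm_num)] at h2
  refine h2.congr fun n => ?_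
  rw [eLpNorm_eq_lintegral_rpow_enorm_toReal (by simp) (by simp)]
  simp

end Holder

/-! ### Test functions on `Ω` and their Sobolev inequality. -/

section Test

variable {χ : E3 → ℝ}

theorem norm_gradient (f : E3 → ℝ) (x : E3) : ‖gradient f x‖ = ‖fderiv ℝ f x‖ := by
  rw [← toDual_gradient, LinearIsometryEquiv.norm_map]

theorem IsTest.continuous_gradient (hχ : IsTest χ) : Continuous (gradient χ) :=
  (InnerProductSpace.toDual ℝ E3).symm.continuous.comp
    (hχ.smooth.continuous_fderiv (by simp))

theorem IsTest.hasGradientAt (hχ : IsTest χ) (x : E3) : HasGradientAt χ (gradient χ x) x :=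
  (hχ.smooth.differentiable (by simp) x).hasGradientAt

theorem IsTest.memLp (hχ : IsTest χ) (p : ℝ≥0∞) : MemLp χ p muOm :=
  (hχ.smooth.continuous.memLp_of_hasCompactSupport hχ.compact).restrict _

theorem IsTest.memLp_gradient (hχ : IsTest χ) (p : ℝ≥0∞) : MemLp (gradient χ) p muOm := by
  refine (hχ.continuous_gradient.memLp_of_hasCompactSupport ?_).restrict _
  refine (hχ.compact.fderiv ℝ).comp_left (g := (InnerProductSpace.toDual ℝ E3).symm) ?_
  simp

/-- The constant of the Sobolev embedding of `Ḣ¹` into `L⁶` in three dimensions. -/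
def sobolevConst : ℝ≥0 := SNormLESNormFDerivOfEqConst ℝ (volume : Measure E3) 2

/-- Since `χ` and its derivative are supported in `Ω`, both norms equal the norms over all of `ℝ³`,
where the Gagliardo–Nirenberg–Sobolev inequality applies. -/
theorem IsTest.eLpNorm_six_le (hχ : IsTest χ) :
    eLpNorm χ 6 muOm ≤ sobolevConst * eLpNorm (gradient χ) 2 muOm := by
  have hs : Function.support χ ⊆ Om := (subset_tsupport χ).trans hχ.support
  have hs' : Function.support (fderiv ℝ χ) ⊆ Om :=
    (subset_tsupport _).trans ((tsupport_fderiv_subset ℝ).trans hχ.support)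
  have e : eLpNorm (gradient χ) 2 muOm = eLpNorm (fderiv ℝ χ) 2 muOm :=
    eLpNorm_congr_norm_ae (Eventually.of_forall fun x => norm_gradient χ x)
  rw [e, muOm, eLpNorm_restrict_eq_of_support_subset hs]
  rw [eLpNorm_restrict_eq_of_support_subset (f := fderiv ℝ χ) hs']
  have := eLpNorm_le_eLpNorm_fderiv_of_eq (volume : Measure E3) (u := χ) (p := 2) (p' := 6)
    (hχ.smooth.of_le (by simp)) hχ.compact (by norm_num) (by simp)
    (by simp only [finrank_euclideanSpace, Fintype.card_fin]; norm_num)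
  exact_mod_cast this

theorem IsTest.sub {χ' : E3 → ℝ} (hχ : IsTest χ) (hχ' : IsTest χ') :
    IsTest (fun x => χ x - χ' x) where
  smooth := hχ.smooth.sub hχ'.smooth
  compact := hχ.compact.sub hχ'.compact
  support := (tsupport_sub χ χ').trans (union_subset hχ.support hχ'.support)

theorem IsTest.mul_left {θ : E3 → ℝ} (hθ : ContDiff ℝ ∞ θ) (hχ : IsTest χ) :
    IsTest (fun x => θ x * χ x) where
  smooth := hθ.mul hχ.smooth
  compact := hχ.compact.mul_left
  support := (tsupport_mul_subset_right (f := θ) (g := χ)).trans hχ.support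

theorem gradient_mul_of_differentiable {θ : E3 → ℝ} {x : E3} (hθ : DifferentiableAt ℝ θ x)
    (hχ : DifferentiableAt ℝ χ x) :
    gradient (fun x => θ x * χ x) x = θ x • gradient χ x + χ x • gradient θ x := by
  apply (InnerProductSpace.toDual ℝ E3).injective
  rw [map_add, map_smul, map_smul]
  simp only [toDual_gradient]
  exact fderiv_fun_mul hθ hχ

end Test

/-! ### Consequences of approximation by test functions in `Ḣ¹_D(Ω)`. -/

section Sobolev

variable {f f' : E3 → ℝ} {G G' : E3 → E3}

theorem MemH1D.memLp_six (h : MemH1D f G) (hf : Measurable f) : MemLp f 6 muOm := by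
  obtain ⟨χ, hχ, h6, -⟩ := h
  obtain ⟨n, hn⟩ := (h6.eventually (gt_mem_nhds ENNReal.zero_lt_top)).exists
  have h1 : MemLp (fun x => χ n x - f x) 6 muOm :=
    ⟨((hχ n).smooth.continuous.measurable.sub hf).aestronglyMeasurable, hn⟩
  have h2 := ((hχ n).memLp 6).sub h1
  refine h2.congr_norm hf.aestronglyMeasurable (Eventually.of_forall fun x => ?_)
  simp

theorem MemH1D.memLp_grad (h : MemH1D f G) (hG : Measurable G) : MemLp G 2 muOm := by
  obtain ⟨χ, hχ, -, h2⟩ := h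
  obtain ⟨n, hn⟩ := (h2.eventually (gt_mem_nhds ENNReal.zero_lt_top)).exists
  have h1 : MemLp (fun x => gradient (χ n) x - G x) 2 muOm :=
    ⟨((hχ n).continuous_gradient.measurable.sub hG).aestronglyMeasurable, hn⟩
  have h2 := ((hχ n).memLp_gradient 2).sub h1
  refine h2.congr_norm hG.aestronglyMeasurable (Eventually.of_forall fun x => ?_)
  simp

theorem MemH1D.eLpNorm_six_le (h : MemH1D f G) (hf : Measurable f) (hG : Measurable G) :
    eLpNorm f 6 muOm ≤ sobolevConst * eLpNorm G 2 muOm := by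
  obtain ⟨χ, hχ, h6, h2⟩ := h
  have hlim := h6.add (ENNReal.Tendsto.const_mul (a := (sobolevConst : ℝ≥0∞))
    (h2.add_const (eLpNorm G 2 muOm)) (Or.inr ENNReal.coe_ne_top))
  simp only [zero_add] at hlim
  refine ge_of_tendsto' hlim fun n => ?_
  have hm : AEStronglyMeasurable (χ n) muOm :=
    (hχ n).smooth.continuous.measurable.aestronglyMeasurable
  have hm' : AEStronglyMeasurable (gradient (χ n)) muOm :=
    (hχ n).continuous_gradient.measurable.aestronglyMeasurable
  have hf' : AEStronglyMeasurable f muOm := hf.aestronglyMeasurable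
  have hG' : AEStronglyMeasurable G muOm := hG.aestronglyMeasurable
  calc eLpNorm f 6 muOm
      = eLpNorm (fun x => (χ n x - (χ n x - f x))) 6 muOm := by simp
    _ ≤ eLpNorm (χ n) 6 muOm + eLpNorm (fun x => χ n x - f x) 6 muOm :=
        eLpNorm_sub_le hm (hm.sub hf') (by norm_num)
    _ ≤ sobolevConst * eLpNorm (gradient (χ n)) 2 muOm
          + eLpNorm (fun x => χ n x - f x) 6 muOm := by
        gcongr
        exact (hχ n).eLpNorm_six_le
    _ ≤ sobolevConst * (eLpNorm (fun x => gradient (χ n) x - G x) 2 muOm + eLpNorm G 2 muOm)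
          + eLpNorm (fun x => χ n x - f x) 6 muOm := by
        gcongr
        calc eLpNorm (gradient (χ n)) 2 muOm
            = eLpNorm (fun x => (gradient (χ n) x - G x) + G x) 2 muOm := by simp
          _ ≤ _ := eLpNorm_add_le (hm'.sub hG') hG' (by norm_num)
    _ = _ := add_comm _ _

theorem MemH1D.sub (h : MemH1D f G) (h' : MemH1D f' G') (hf : Measurable f) (hG : Measurable G)
    (hf' : Measurable f') (hG' : Measurable G') :
    MemH1D (fun x => f x - f' x) (fun x => G x - G' x) := by
  obtain ⟨χ, hχ, h6, h2⟩ := h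
  obtain ⟨χ', hχ', h6', h2'⟩ := h'
  refine ⟨fun n x => χ n x - χ' n x, fun n => (hχ n).sub (hχ' n), ?_, ?_⟩
  · have := h6.add h6'
    rw [add_zero] at this
    refine tendsto_of_tendsto_of_tendsto_of_le_of_le tendsto_const_nhds this
      (fun n => zero_le) fun n => ?_
    have e : (fun x => χ n x - χ' n x - (f x - f' x))
        = (fun x => χ n x - f x) - fun x => χ' n x - f' x := by
      ext x; simp only [Pi.sub_apply]; ring
    simp only [e]
    exact eLpNorm_sub_le
      ((hχ n).smooth.continuous.measurable.sub hf).aestronglyMeasurable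
      ((hχ' n).smooth.continuous.measurable.sub hf').aestronglyMeasurable (by norm_num)
  · have := h2.add h2'
    rw [add_zero] at this
    refine tendsto_of_tendsto_of_tendsto_of_le_of_le tendsto_const_nhds this
      (fun n => zero_le) fun n => ?_
    have e : (fun x => gradient (fun x => χ n x - χ' n x) x - (G x - G' x))
        = (fun x => gradient (χ n) x - G x) - fun x => gradient (χ' n) x - G' x := by
      ext1 x
      have : gradient (fun x => χ n x - χ' n x) x = gradient (χ n) x - gradient (χ' n) x := by
        apply (InnerProductSpace.toDual ℝ E3).injective
        rw [map_sub]
        simp only [toDual_gradient]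
        exact fderiv_fun_sub ((hχ n).smooth.differentiable (by simp) x)
          ((hχ' n).smooth.differentiable (by simp) x)
      rw [this]
      simp only [Pi.sub_apply]
      abel
    simp only [e]
    exact eLpNorm_sub_le
      ((hχ n).continuous_gradient.measurable.sub hG).aestronglyMeasurable
      ((hχ' n).continuous_gradient.measurable.sub hG').aestronglyMeasurable (by norm_num)

end Sobolev

/-! ### Density of test functions in `Ḣ¹_D(Ω) ∩ L²(Ω)`. -/

section Density

/-- A smooth cutoff equal to `1` on the unit ball and supported in the ball of radius `2`. -/
def unitBump : ContDiffBump (0 : E3) := ⟨1, 2, one_pos, one_lt_two⟩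

/-- The dilated cutoff, equal to `1` on the ball of radius `n + 1`. -/
def spaceCutoff (n : ℕ) (x : E3) : ℝ := unitBump (((n : ℝ) + 1)⁻¹ • x)

theorem contDiff_spaceCutoff (n : ℕ) : ContDiff ℝ ∞ (spaceCutoff n) :=
  unitBump.contDiff.comp (contDiff_const_smul _)

theorem hasCompactSupport_spaceCutoff (n : ℕ) : HasCompactSupport (spaceCutoff n) :=
  unitBump.hasCompactSupport.comp_homeomorph
    (Homeomorph.smulOfNeZero (((n : ℝ) + 1)⁻¹) (by positivity))

theorem abs_spaceCutoff_le (n : ℕ) (x : E3) : ‖spaceCutoff n x‖ ≤ 1 := by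
  rw [Real.norm_of_nonneg (show 0 ≤ spaceCutoff n x from unitBump.nonneg' _)]
  exact unitBump.le_one

theorem abs_spaceCutoff_sub_one_le (n : ℕ) (x : E3) : ‖spaceCutoff n x - 1‖ ≤ 1 := by
  have h0 : 0 ≤ spaceCutoff n x := unitBump.nonneg' _
  have h1 : spaceCutoff n x ≤ 1 := unitBump.le_one
  rw [Real.norm_eq_abs, abs_le]
  constructor <;> linarith

theorem tendsto_spaceCutoff_sub_one (x : E3) :
    ∀ᶠ n in atTop, spaceCutoff n x - 1 = 0 := by
  obtain ⟨N, hN⟩ := exists_nat_ge ‖x‖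
  filter_upwards [eventually_ge_atTop N] with n hn
  have hn' : (N : ℝ) ≤ n := by exact_mod_cast hn
  rw [sub_eq_zero]
  refine unitBump.one_of_mem_closedBall ?_
  rw [mem_closedBall_zero_iff, norm_smul, norm_inv, Real.norm_of_nonneg (by positivity)]
  show _ ≤ (1 : ℝ)
  rw [inv_mul_le_iff₀ (by positivity)]
  linarith

theorem exists_gradient_spaceCutoff_bound :
    ∃ C : ℝ, 0 ≤ C ∧ ∀ n x, ‖gradient (spaceCutoff n) x‖ ≤ C / ((n : ℝ) + 1) := by
  have hc : Continuous (fderiv ℝ (unitBump : E3 → ℝ)) :=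
    (unitBump.contDiff (n := 1)).continuous_fderiv (by simp)
  obtain ⟨C, hC⟩ := hc.bounded_above_of_compact_support (unitBump.hasCompactSupport.fderiv ℝ)
  refine ⟨C, (norm_nonneg _).trans (hC 0), fun n x => ?_⟩
  rw [norm_gradient]
  have h1 : HasFDerivAt (spaceCutoff n) ((fderiv ℝ unitBump (((n : ℝ) + 1)⁻¹ • x)).comp
      (((n : ℝ) + 1)⁻¹ • ContinuousLinearMap.id ℝ E3)) x := by
    refine HasFDerivAt.comp x (g := unitBump)
      ((unitBump.contDiff (n := 1)).differentiable (by simp) _).hasFDerivAt ?_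
    exact (hasFDerivAt_id (𝕜 := ℝ) x).const_smul (((n : ℝ) + 1)⁻¹)
  rw [h1.fderiv, ContinuousLinearMap.comp_smul, ContinuousLinearMap.comp_id, norm_smul, norm_inv,
    Real.norm_of_nonneg (by positivity), div_eq_inv_mul]
  gcongr
  exact hC _

variable {f : E3 → ℝ} {G : E3 → E3}

/-- Functions in `Ḣ¹_D(Ω) ∩ L²(Ω)` are limits of test functions in the inhomogeneous norm. -/
theorem MemH1D.exists_test_lt (h : MemH1D f G) (hf : Measurable f) (hG : Measurable G)
    (hf2 : MemLp f 2 muOm) {ε : ℝ≥0∞} (hε : 0 < ε) :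
    ∃ χ, IsTest χ ∧ eLpNorm (fun x => χ x - f x) 2 muOm < ε ∧
      eLpNorm (fun x => gradient χ x - G x) 2 muOm < ε := by
  have := holderTriple_six_three_two
  have hG2 := h.memLp_grad hG
  obtain ⟨χ, hχ, h6, h2⟩ := h
  obtain ⟨C, hC0, hC⟩ := exists_gradient_spaceCutoff_bound
  have hcm : ∀ n, Measurable (spaceCutoff n) := fun n =>
    (contDiff_spaceCutoff n).continuous.measurable
  have hgc : ∀ n, Continuous (gradient (spaceCutoff n)) := fun n =>
    (InnerProductSpace.toDual ℝ E3).symm.continuous.comp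
      ((contDiff_spaceCutoff n).continuous_fderiv (by simp))
  have hgm : ∀ n, Measurable (gradient (spaceCutoff n)) := fun n => (hgc n).measurable
  have t1 : Tendsto (fun n => eLpNorm (fun x => (spaceCutoff n x - 1) * f x) 2 muOm) atTop
      (𝓝 0) := by
    refine tendsto_eLpNorm_two_zero_of_dominated
      (fun n => (((hcm n).sub_const 1).mul hf).aestronglyMeasurable) hf2 (fun n x => ?_)
      (fun x => ?_)
    · rw [norm_mul]
      exact mul_le_of_le_one_left (norm_nonneg _) (abs_spaceCutoff_sub_one_le n x)
    · refine tendsto_const_nhds.congr' ?_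
      filter_upwards [tendsto_spaceCutoff_sub_one x] with n hn
      rw [hn, zero_mul]
  have t2 : Tendsto (fun n => eLpNorm (fun x => (spaceCutoff n x - 1) • G x) 2 muOm) atTop
      (𝓝 0) := by
    refine tendsto_eLpNorm_two_zero_of_dominated
      (fun n => (((hcm n).sub_const 1).smul hG).aestronglyMeasurable) hG2 (fun n x => ?_)
      (fun x => ?_)
    · rw [norm_smul]
      exact mul_le_of_le_one_left (norm_nonneg _) (abs_spaceCutoff_sub_one_le n x)
    · refine tendsto_const_nhds.congr' ?_
      filter_upwards [tendsto_spaceCutoff_sub_one x] with n hn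
      rw [hn, zero_smul]
  -- The commutator of the cutoff with the gradient: `f ∈ L²` and `|∇θ_n| ≤ C/(n+1)`, where `θ_n` is
  -- the cutoff.
  have t3 : Tendsto (fun n => eLpNorm (fun x => f x • gradient (spaceCutoff n) x) 2 muOm) atTop
      (𝓝 0) := by
    have hz : Tendsto (fun n : ℕ => ENNReal.ofReal (C / ((n : ℝ) + 1)) * eLpNorm f 2 muOm) atTop
        (𝓝 0) := by
      have := ENNReal.tendsto_ofReal ((tendsto_const_div_atTop_nhds_zero_nat C).comp
        (tendsto_add_atTop_nat 1))
      have := ENNReal.Tendsto.mul_const (b := eLpNorm f 2 muOm) this (Or.inr hf2.2.ne)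
      simpa [Function.comp_def] using this
    refine tendsto_of_tendsto_of_tendsto_of_le_of_le tendsto_const_nhds hz
      (fun n => zero_le) fun n => ?_
    refine eLpNorm_le_mul_eLpNorm_of_ae_le_mul (Eventually.of_forall fun x => ?_) 2
    rw [norm_smul, mul_comm]
    gcongr
    exact hC n x
  have hT1 := t1
  have hT2 := t2.add t3
  rw [add_zero] at hT2
  -- The cutoff radius is fixed before the approximant: `L⁶` convergence of `χ m` becomes `L²`
  -- convergence only after multiplication by a fixed function in `L³`, namely the cutoff or its
  -- gradient.
  obtain ⟨n, hn1, hn2⟩ :=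
    ((hT1.eventually (gt_mem_nhds hε)).and (hT2.eventually (gt_mem_nhds hε))).exists
  have c3 : MemLp (spaceCutoff n) 3 muOm :=
    ((contDiff_spaceCutoff n).continuous.memLp_of_hasCompactSupport
      (hasCompactSupport_spaceCutoff n)).restrict _
  have g3 : MemLp (gradient (spaceCutoff n)) 3 muOm := by
    refine ((hgc n).memLp_of_hasCompactSupport ?_).restrict _
    refine ((hasCompactSupport_spaceCutoff n).fderiv ℝ).comp_left
      (g := (InnerProductSpace.toDual ℝ E3).symm) ?_
    simp
  have s1 : Tendsto (fun m => eLpNorm (fun x => χ m x - f x) 6 muOm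
      * eLpNorm (spaceCutoff n) 3 muOm + eLpNorm (fun x => (spaceCutoff n x - 1) * f x) 2 muOm)
      atTop (𝓝 (eLpNorm (fun x => (spaceCutoff n x - 1) * f x) 2 muOm)) := by
    have := (ENNReal.Tendsto.mul_const h6 (Or.inr c3.2.ne)).add_const
      (eLpNorm (fun x => (spaceCutoff n x - 1) * f x) 2 muOm)
    simpa using this
  have s2 : Tendsto (fun m => (eLpNorm (fun x => gradient (χ m) x - G x) 2 muOm
      + eLpNorm (fun x => χ m x - f x) 6 muOm * eLpNorm (gradient (spaceCutoff n)) 3 muOm)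
      + (eLpNorm (fun x => (spaceCutoff n x - 1) • G x) 2 muOm
        + eLpNorm (fun x => f x • gradient (spaceCutoff n) x) 2 muOm))
      atTop (𝓝 (eLpNorm (fun x => (spaceCutoff n x - 1) • G x) 2 muOm
        + eLpNorm (fun x => f x • gradient (spaceCutoff n) x) 2 muOm)) := by
    have := (h2.add (ENNReal.Tendsto.mul_const h6 (Or.inr g3.2.ne))).add_const
      (eLpNorm (fun x => (spaceCutoff n x - 1) • G x) 2 muOm
        + eLpNorm (fun x => f x • gradient (spaceCutoff n) x) 2 muOm)
    simpa using this
  obtain ⟨m, hm1, hm2⟩ :=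
    ((s1.eventually (gt_mem_nhds hn1)).and (s2.eventually (gt_mem_nhds hn2))).exists
  have hχm : Measurable (χ m) := (hχ m).smooth.continuous.measurable
  have hχgm : Measurable (gradient (χ m)) := (hχ m).continuous_gradient.measurable
  refine ⟨fun x => spaceCutoff n x * χ m x, (hχ m).mul_left (contDiff_spaceCutoff n),
    lt_of_le_of_lt ?_ hm1, lt_of_le_of_lt ?_ hm2⟩
  · have e : (fun x => spaceCutoff n x * χ m x - f x)
        = (fun x => (χ m x - f x) • spaceCutoff n x) + fun x => (spaceCutoff n x - 1) * f x := by
      ext x; simp only [Pi.add_apply, smul_eq_mul]; ring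
    rw [e]
    have m1 : Measurable fun x => (χ m x - f x) • spaceCutoff n x := (hχm.sub hf).smul (hcm n)
    have m2 : Measurable fun x => (spaceCutoff n x - 1) * f x := ((hcm n).sub_const 1).mul hf
    refine (eLpNorm_add_le m1.aestronglyMeasurable m2.aestronglyMeasurable
      (by norm_num)).trans ?_
    gcongr
    exact eLpNorm_fun_smul_le (p := 6) (q := 3) (r := 2)
      (hχm.sub hf).aestronglyMeasurable (hcm n).aestronglyMeasurable
  · have e : (fun x => gradient (fun x => spaceCutoff n x * χ m x) x - G x)
        = ((fun x => spaceCutoff n x • (gradient (χ m) x - G x))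
          + fun x => (χ m x - f x) • gradient (spaceCutoff n) x)
          + ((fun x => (spaceCutoff n x - 1) • G x)
          + fun x => f x • gradient (spaceCutoff n) x) := by
      ext1 x
      rw [gradient_mul_of_differentiable ((contDiff_spaceCutoff n).differentiable (by simp) x)
        ((hχ m).smooth.differentiable (by simp) x)]
      simp only [Pi.add_apply, smul_sub, sub_smul, one_smul]
      abel
    rw [e]
    have m1 : Measurable fun x => spaceCutoff n x • (gradient (χ m) x - G x) :=
      (hcm n).smul (hχgm.sub hG)
    have m2 : Measurable fun x => (χ m x - f x) • gradient (spaceCutoff n) x :=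
      (hχm.sub hf).smul (hgm n)
    have m3 : Measurable fun x => (spaceCutoff n x - 1) • G x := ((hcm n).sub_const 1).smul hG
    have m4 : Measurable fun x => f x • gradient (spaceCutoff n) x := hf.smul (hgm n)
    refine (eLpNorm_add_le (m1.add m2).aestronglyMeasurable (m3.add m4).aestronglyMeasurable
      (by norm_num)).trans (add_le_add ((eLpNorm_add_le m1.aestronglyMeasurable
      m2.aestronglyMeasurable (by norm_num)).trans (add_le_add ?_ ?_))
      (eLpNorm_add_le m3.aestronglyMeasurable m4.aestronglyMeasurable (by norm_num)))
    · refine eLpNorm_mono fun x => ?_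
      rw [norm_smul]
      exact mul_le_of_le_one_left (norm_nonneg _) (abs_spaceCutoff_le n x)
    · exact eLpNorm_fun_smul_le (p := 6) (q := 3) (r := 2)
        (hχm.sub hf).aestronglyMeasurable (hgm n).aestronglyMeasurable

theorem MemH1D.exists_seq_test (h : MemH1D f G) (hf : Measurable f) (hG : Measurable G)
    (hf2 : MemLp f 2 muOm) :
    ∃ χ : ℕ → E3 → ℝ, (∀ n, IsTest (χ n)) ∧
      Tendsto (fun n => eLpNorm (fun x => χ n x - f x) 2 muOm) atTop (𝓝 0) ∧
      Tendsto (fun n => eLpNorm (fun x => gradient (χ n) x - G x) 2 muOm) atTop (𝓝 0) := by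
  -- At `n = 0` the tolerance is `∞`, which is still positive.
  choose χ hχ h1 h2 using fun n : ℕ => h.exists_test_lt hf hG hf2
    (ε := ((n : ℝ≥0∞))⁻¹) (ENNReal.inv_pos.2 (ENNReal.natCast_ne_top n))
  exact ⟨χ, hχ,
    tendsto_of_tendsto_of_tendsto_of_le_of_le tendsto_const_nhds
      ENNReal.tendsto_inv_nat_nhds_zero (fun n => zero_le) fun n => (h1 n).le,
    tendsto_of_tendsto_of_tendsto_of_le_of_le tendsto_const_nhds
      ENNReal.tendsto_inv_nat_nhds_zero (fun n => zero_le) fun n => (h2 n).le⟩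

end Density

/-! ### Passage from functions to classes in `L²(Ω)`, and from `[0, b]` to all times. -/

section ToL2

variable {F : Type*} [NormedAddCommGroup F]

/-- The class in `L²(Ω)` of a square integrable function, and `0` for other functions. -/
def toL2 (f : E3 → F) : Lp F 2 muOm :=
  open Classical in if h : MemLp f 2 muOm then h.toLp f else 0

theorem toL2_eq {f : E3 → F} (hf : MemLp f 2 muOm) : toL2 f = hf.toLp f := by
  rw [toL2, dif_pos hf]

theorem coeFn_toL2 {f : E3 → F} (hf : MemLp f 2 muOm) : toL2 f =ᵐ[muOm] f := by
  rw [toL2_eq hf]; exact hf.coeFn_toLp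

theorem norm_toL2 {f : E3 → F} (hf : MemLp f 2 muOm) :
    ‖toL2 f‖ = (eLpNorm f 2 muOm).toReal := by
  rw [toL2_eq hf, Lp.norm_toLp]

theorem toL2_sub {f g : E3 → F} (hf : MemLp f 2 muOm) (hg : MemLp g 2 muOm) :
    toL2 (fun x => f x - g x) = toL2 f - toL2 g := by
  rw [toL2_eq hf, toL2_eq hg, toL2_eq (f := fun x => f x - g x) (hf.sub hg)]
  rfl

theorem toL2_smul [InnerProductSpace ℝ F] {f : E3 → F} (c : ℝ) (hf : MemLp f 2 muOm) :
    toL2 (fun x => c • f x) = c • toL2 f := by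
  rw [toL2_eq hf, toL2_eq (f := fun x => c • f x) (hf.const_smul c)]
  rfl

theorem inner_toL2 [InnerProductSpace ℝ F] {f g : E3 → F} (hf : MemLp f 2 muOm)
    (hg : MemLp g 2 muOm) :
    inner ℝ (toL2 f) (toL2 g) = ∫ x, inner ℝ (f x) (g x) ∂muOm := by
  rw [L2.inner_def]
  refine integral_congr_ae ?_
  filter_upwards [coeFn_toL2 hf, coeFn_toL2 hg] with x h1 h2
  rw [h1, h2]

theorem integrable_inner_of_memLp [InnerProductSpace ℝ F] {f g : E3 → F}
    (hf : MemLp f 2 muOm) (hg : MemLp g 2 muOm) :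
    Integrable (fun x => inner ℝ (f x) (g x)) muOm := by
  refine (L2.integrable_inner (𝕜 := ℝ) (toL2 f) (toL2 g)).congr ?_
  filter_upwards [coeFn_toL2 hf, coeFn_toL2 hg] with x h1 h2
  rw [h1, h2]

theorem inner_toL2_real {f g : E3 → ℝ} (hf : MemLp f 2 muOm) (hg : MemLp g 2 muOm) :
    inner ℝ (toL2 f) (toL2 g) = ∫ x, f x * g x ∂muOm := by
  rw [inner_toL2 hf hg]
  simp [mul_comm]

theorem integrable_mul_of_memLp {f g : E3 → ℝ} (hf : MemLp f 2 muOm) (hg : MemLp g 2 muOm) :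
    Integrable (fun x => f x * g x) muOm := by
  simpa [mul_comm] using integrable_inner_of_memLp hf hg

theorem tendsto_toL2 {ι : Type*} {l : Filter ι} {f : ι → E3 → F} {g : E3 → F}
    (hf : ∀ᶠ i in l, MemLp (f i) 2 muOm) (hg : MemLp g 2 muOm)
    (h : Tendsto (fun i => eLpNorm (fun x => f i x - g x) 2 muOm) l (𝓝 0)) :
    Tendsto (fun i => toL2 (f i)) l (𝓝 (toL2 g)) := by
  rw [tendsto_iff_norm_sub_tendsto_zero]
  have h1 := (ENNReal.tendsto_toReal ENNReal.zero_ne_top).comp h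
  rw [ENNReal.toReal_zero] at h1
  refine h1.congr' ?_
  filter_upwards [hf] with i hi
  rw [← toL2_sub hi hg]
  exact (norm_toL2 (hi.sub hg)).symm

/-- The projection of the real line to `[0, b]`. -/
def clamp (b t : ℝ) : ℝ := max 0 (min t b)

theorem continuous_clamp (b : ℝ) : Continuous (clamp b) :=
  continuous_const.max (continuous_id.min continuous_const)

theorem clamp_mem {b : ℝ} (hb : 0 ≤ b) (t : ℝ) : clamp b t ∈ Icc 0 b :=
  ⟨le_max_left _ _, max_le hb (min_le_right _ _)⟩

theorem clamp_eq {b t : ℝ} (ht : t ∈ Icc 0 b) : clamp b t = t := by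
  rw [clamp, min_eq_left ht.2, max_eq_right ht.1]

theorem continuous_toL2_clamp {u : ℝ → E3 → F} {s : Set ℝ} {b : ℝ} (hb : 0 ≤ b)
    (hs : Icc 0 b ⊆ s) (hu : ∀ t ∈ s, MemLp (u t) 2 muOm)
    (hc : ∀ t₀ ∈ s, Tendsto (fun t => eLpNorm (fun x => u t x - u t₀ x) 2 muOm) (𝓝[s] t₀)
      (𝓝 0)) :
    Continuous fun t => toL2 (u (clamp b t)) := by
  refine continuous_iff_continuousAt.2 fun t₀ => ?_
  have hm : ∀ t, clamp b t ∈ s := fun t => hs (clamp_mem hb t)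
  have ht : Tendsto (clamp b) (𝓝 t₀) (𝓝[s] (clamp b t₀)) :=
    tendsto_nhdsWithin_iff.2 ⟨(continuous_clamp b).tendsto t₀, Eventually.of_forall hm⟩
  exact tendsto_toL2 (Eventually.of_forall fun t => hu _ (hm t)) (hu _ (hm t₀))
    ((hc _ (hm t₀)).comp ht)

end ToL2

/-! ### The nonlinearity `v³` and the potential `v⁴/4`. -/

section Cubes

theorem eLpNorm_cube_sub_cube_le {f g : E3 → ℝ} (hf : Measurable f) (hg : Measurable g) :
    eLpNorm (fun x => f x ^ 3 - g x ^ 3) 2 muOm ≤ eLpNorm (fun x => f x - g x) 6 muOm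
      * (eLpNorm f 6 muOm * eLpNorm f 6 muOm + eLpNorm f 6 muOm * eLpNorm g 6 muOm
        + eLpNorm g 6 muOm * eLpNorm g 6 muOm) := by
  have hd : Measurable fun x => f x - g x := hf.sub hg
  have e : (fun x => f x ^ 3 - g x ^ 3) = ((fun x => (f x - g x) * (f x * f x))
      + fun x => (f x - g x) * (f x * g x)) + fun x => (f x - g x) * (g x * g x) := by
    ext x; simp only [Pi.add_apply]; ring
  have m1 : Measurable fun x => (f x - g x) * (f x * f x) := hd.mul (hf.mul hf)
  have m2 : Measurable fun x => (f x - g x) * (f x * g x) := hd.mul (hf.mul hg)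
  have m3 : Measurable fun x => (f x - g x) * (g x * g x) := hd.mul (hg.mul hg)
  rw [e, mul_add, mul_add]
  refine (eLpNorm_add_le (m1.add m2).aestronglyMeasurable m3.aestronglyMeasurable
    (by norm_num)).trans (add_le_add ((eLpNorm_add_le m1.aestronglyMeasurable
    m2.aestronglyMeasurable (by norm_num)).trans (add_le_add ?_ ?_)) ?_)
  · exact eLpNorm_mul_mul_le hd.aestronglyMeasurable hf.aestronglyMeasurable
      hf.aestronglyMeasurable
  · exact eLpNorm_mul_mul_le hd.aestronglyMeasurable hf.aestronglyMeasurable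
      hg.aestronglyMeasurable
  · exact eLpNorm_mul_mul_le hd.aestronglyMeasurable hg.aestronglyMeasurable
      hg.aestronglyMeasurable

theorem memLp_cube {f : E3 → ℝ} (hf : MemLp f 6 muOm) : MemLp (fun x => f x ^ 3) 2 muOm := by
  have := memLp_mul_mul hf hf hf
  refine this.congr_norm (hf.1.pow 3) (Eventually.of_forall fun x => ?_)
  congr 1; ring

theorem tendsto_eLpNorm_cube {ι : Type*} {l : Filter ι} {f : ι → E3 → ℝ} {g : E3 → ℝ}
    (hf : ∀ i, Measurable (f i)) (hg : Measurable g) (hg6 : MemLp g 6 muOm)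
    (h : Tendsto (fun i => eLpNorm (fun x => f i x - g x) 6 muOm) l (𝓝 0)) :
    Tendsto (fun i => eLpNorm (fun x => f i x ^ 3 - g x ^ 3) 2 muOm) l (𝓝 0) := by
  set B := 1 + eLpNorm g 6 muOm with hB
  have hBt : B ≠ ⊤ := ENNReal.add_ne_top.2 ⟨ENNReal.one_ne_top, hg6.2.ne⟩
  have hz : Tendsto (fun i => eLpNorm (fun x => f i x - g x) 6 muOm * (B * B + B * B + B * B))
      l (𝓝 0) := by
    have := ENNReal.Tendsto.mul_const (b := B * B + B * B + B * B) h (Or.inr ?_)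
    · simpa using this
    · simp [ENNReal.mul_eq_top, hBt]
  refine tendsto_of_tendsto_of_tendsto_of_le_of_le' tendsto_const_nhds hz
    (Eventually.of_forall fun n => zero_le) ?_
  filter_upwards [h.eventually (gt_mem_nhds one_pos)] with i hi
  have h1 : eLpNorm (f i) 6 muOm ≤ B := by
    calc eLpNorm (f i) 6 muOm = eLpNorm (fun x => (f i x - g x) + g x) 6 muOm := by simp
      _ ≤ _ := eLpNorm_add_le ((hf i).sub hg).aestronglyMeasurable hg.aestronglyMeasurable
        (by norm_num)
      _ ≤ B := add_le_add hi.le le_rfl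
  have h2 : eLpNorm g 6 muOm ≤ B := le_add_self
  exact (eLpNorm_cube_sub_cube_le (hf i) hg).trans (by gcongr)

/-- The graph of the convex function `a⁴/4` lies above its tangent at `b`. -/
theorem cube_mul_sub_le (a b : ℝ) : b ^ 3 * (a - b) ≤ a ^ 4 / 4 - b ^ 4 / 4 := by
  nlinarith [sq_nonneg (a ^ 2 - b ^ 2), sq_nonneg (a - b), mul_nonneg (sq_nonneg b)
    (sq_nonneg (a - b))]

/-- The tangent inequality at `f` reads `f⁴ ≤ g⁴ + 4 f³ (f - g)`, where `f³` and `f - g` are both in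
`L²`. -/
theorem integrable_pow_four_of_sub {f g : E3 → ℝ} (hf : Measurable f) (hf6 : MemLp f 6 muOm)
    (hfg : MemLp (fun x => f x - g x) 2 muOm) (hg4 : Integrable (fun x => g x ^ 4) muOm) :
    Integrable (fun x => f x ^ 4) muOm := by
  refine (hg4.add ((integrable_mul_of_memLp (memLp_cube hf6) hfg).const_mul 4)).mono'
    (hf.pow_const 4).aestronglyMeasurable (Eventually.of_forall fun x => ?_)
  rw [Real.norm_of_nonneg (by positivity)]
  have := cube_mul_sub_le (g x) (f x)
  simp only [Pi.add_apply]
  linarith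

end Cubes

/-! ### The time interval. -/

section Interval

theorem isPreconnected_timeInterval (T : ℝ≥0∞) : IsPreconnected (timeInterval T) := by
  refine OrdConnected.isPreconnected ⟨fun x hx y hy z hz => ⟨hx.1.trans hz.1, ?_⟩⟩
  exact (ENNReal.ofReal_le_ofReal hz.2).trans_lt hy.2

theorem Icc_subset_timeInterval {T : ℝ≥0∞} {b : ℝ} (hb : b ∈ timeInterval T) :
    Icc 0 b ⊆ timeInterval T :=
  fun _ ht => ⟨ht.1, (ENNReal.ofReal_le_ofReal ht.2).trans_lt hb.2⟩

theorem exists_gt_mem_timeInterval {T : ℝ≥0∞} {t : ℝ} (ht : t ∈ timeInterval T) :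
    ∃ b, t < b ∧ b ∈ timeInterval T := by
  obtain ⟨c, hc1, hc2⟩ := exists_between ht.2
  have hc : c ≠ ⊤ := hc2.ne_top
  have h1 : t < c.toReal := (ENNReal.ofReal_lt_iff_lt_toReal ht.1 hc).1 hc1
  exact ⟨c.toReal, h1, ENNReal.toReal_nonneg, by rwa [ENNReal.ofReal_toReal hc]⟩

end Interval

/-! ### Regularity in space and time of energy solutions. -/

section Solution

variable {c₀ c₁ : ℝ → ℝ} {w : ℝ → E3 → ℝ} {T : ℝ≥0∞} {v vt : ℝ → E3 → ℝ} {gv : ℝ → E3 → E3}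

theorem IsEnergySolution.meas_v (h : IsEnergySolution c₀ c₁ w T v vt gv) (t : ℝ) :
    Measurable (v t) := h.measurable_v.comp measurable_prodMk_left

theorem IsEnergySolution.meas_vt (h : IsEnergySolution c₀ c₁ w T v vt gv) (t : ℝ) :
    Measurable (vt t) := h.measurable_vt.comp measurable_prodMk_left

theorem IsEnergySolution.meas_gv (h : IsEnergySolution c₀ c₁ w T v vt gv) (t : ℝ) :
    Measurable (gv t) := h.measurable_gv.comp measurable_prodMk_left

theorem IsEnergySolution.memLp_six (h : IsEnergySolution c₀ c₁ w T v vt gv) {t : ℝ}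
    (ht : t ∈ timeInterval T) : MemLp (v t) 6 muOm :=
  (h.memH1 t ht).memLp_six (h.meas_v t)

theorem IsEnergySolution.memLp_grad (h : IsEnergySolution c₀ c₁ w T v vt gv) {t : ℝ}
    (ht : t ∈ timeInterval T) : MemLp (gv t) 2 muOm :=
  (h.memH1 t ht).memLp_grad (h.meas_gv t)

theorem IsEnergySolution.memH1D_sub (h : IsEnergySolution c₀ c₁ w T v vt gv) {s t : ℝ}
    (hs : s ∈ timeInterval T) (ht : t ∈ timeInterval T) :
    MemH1D (fun x => v t x - v s x) (fun x => gv t x - gv s x) :=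
  (h.memH1 t ht).sub (h.memH1 s hs) (h.meas_v t) (h.meas_gv t) (h.meas_v s) (h.meas_gv s)

theorem IsEnergySolution.tendsto_six (h : IsEnergySolution c₀ c₁ w T v vt gv) {t₀ : ℝ}
    (ht₀ : t₀ ∈ timeInterval T) :
    Tendsto (fun t => eLpNorm (fun x => v t x - v t₀ x) 6 muOm) (𝓝[timeInterval T] t₀)
      (𝓝 0) := by
  have h1 := ENNReal.Tendsto.const_mul (a := (sobolevConst : ℝ≥0∞))
    (h.continuous_H1 t₀ ht₀) (Or.inr ENNReal.coe_ne_top)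
  rw [mul_zero] at h1
  refine tendsto_of_tendsto_of_tendsto_of_le_of_le' tendsto_const_nhds h1
    (Eventually.of_forall fun n => zero_le) ?_
  filter_upwards [self_mem_nhdsWithin] with t ht
  exact (h.memH1D_sub ht₀ ht).eLpNorm_six_le ((h.meas_v t).sub (h.meas_v t₀))
    ((h.meas_gv t).sub (h.meas_gv t₀))

/-- An element of `Ḣ¹_D` need not be in `L²`, but its increments in time are. Near `t₀` this follows
from the convergence of the difference quotients to `vt t₀ ∈ L²`; being in `L²` is symmetric and
transitive for increments, so connectedness of the time interval makes it global. -/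
theorem IsEnergySolution.memLp_sub (h : IsEnergySolution c₀ c₁ w T v vt gv) {s t : ℝ}
    (hs : s ∈ timeInterval T) (ht : t ∈ timeInterval T) :
    MemLp (fun x => v t x - v s x) 2 muOm := by
  refine (isPreconnected_timeInterval T).induction₂
    (fun s t => MemLp (fun x => v t x - v s x) 2 muOm) (fun t₀ ht₀ => ?_) ?_ ?_ hs ht
  · have h1 := (h.time_deriv t₀ ht₀).eventually (gt_mem_nhds ENNReal.zero_lt_top)
    rw [eventually_nhdsWithin_iff] at h1 ⊢
    filter_upwards [h1] with t ht htm
    by_cases htt : t = t₀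
    · subst htt
      simp
    · have m : Measurable fun x => (v t x - v t₀ x) / (t - t₀) - vt t₀ x :=
        (((h.meas_v t).sub (h.meas_v t₀)).div_const _).sub (h.meas_vt t₀)
      have h2 : MemLp (fun x => (v t x - v t₀ x) / (t - t₀) - vt t₀ x) 2 muOm :=
        ⟨m.aestronglyMeasurable, ht ⟨htm, htt⟩⟩
      refine ((h2.add (h.memL2 t₀ ht₀)).const_smul (t - t₀)).congr_norm
        ((h.meas_v t).sub (h.meas_v t₀)).aestronglyMeasurable (Eventually.of_forall fun x => ?_)
      have : t - t₀ ≠ 0 := sub_ne_zero.2 htt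
      simp only [Pi.smul_apply, Pi.add_apply, smul_eq_mul, sub_add_cancel]
      congr 1
      field_simp
  · intro x y z _ _ _ hxy hyz
    refine (hxy.add hyz).congr_norm ((h.meas_v z).sub (h.meas_v x)).aestronglyMeasurable
      (Eventually.of_forall fun a => ?_)
    simp
  · intro x y _ _ hxy
    refine hxy.congr_norm ((h.meas_v x).sub (h.meas_v y)).aestronglyMeasurable
      (Eventually.of_forall fun a => ?_)
    exact norm_sub_rev _ _

/-- Subtracting `v 0` produces a curve in `L²` with the same time derivative as `v`. -/
theorem IsEnergySolution.hasDerivWithinAt (h : IsEnergySolution c₀ c₁ w T v vt gv) {b t₀ : ℝ}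
    (hb : b ∈ timeInterval T) (ht₀ : t₀ ∈ Icc 0 b) :
    HasDerivWithinAt (fun t => toL2 fun x => v t x - v 0 x) (toL2 (vt (clamp b t₀))) (Icc 0 b)
      t₀ := by
  have hsub := Icc_subset_timeInterval hb
  have h0 : (0 : ℝ) ∈ timeInterval T := hsub ⟨le_rfl, hb.1⟩
  have ht₀' := hsub ht₀
  rw [clamp_eq ht₀, hasDerivWithinAt_iff_tendsto_slope, tendsto_iff_norm_sub_tendsto_zero]
  have h1 := (ENNReal.tendsto_toReal ENNReal.zero_ne_top).comp
    ((h.time_deriv t₀ ht₀').mono_left (nhdsWithin_mono _ (sdiff_subset_sdiff_left hsub)))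
  rw [ENNReal.toReal_zero] at h1
  refine h1.congr' ?_
  filter_upwards [self_mem_nhdsWithin] with t ht
  have htT := hsub ht.1
  have m1 := h.memLp_sub h0 htT
  have m2 := h.memLp_sub h0 ht₀'
  have m3 : MemLp (fun x => (v t x - v 0 x) - (v t₀ x - v 0 x)) 2 muOm := m1.sub m2
  have m4 : MemLp (fun x => (t - t₀)⁻¹ • ((v t x - v 0 x) - (v t₀ x - v 0 x))) 2 muOm :=
    m3.const_smul (t - t₀)⁻¹
  have m5 := h.memL2 t₀ ht₀'
  rw [slope_def_module, ← toL2_sub m1 m2, ← toL2_smul _ m3, ← toL2_sub m4 m5,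
    norm_toL2 (f := fun x => _ - _) (m4.sub m5)]
  simp only [Function.comp_apply]
  congr 2
  ext x
  simp only [smul_eq_mul]
  ring

end Solution

/-! ### Size and time integrability of the forcing `-3v²w - 3vw²`. -/

instance : SFinite muOm := by unfold muOm; infer_instance

section Forcing

variable {w : ℝ → E3 → ℝ}

/-- The norm `‖w(t)‖_{L⁶(Ω)}`. -/
def sixNorm (w : ℝ → E3 → ℝ) (t : ℝ) : ℝ≥0∞ := eLpNorm (w t) 6 muOm

/-- The bound `3 m² ‖w(t)‖₆ + 3 m ‖w(t)‖₆²` for `‖3 v² w + 3 v w²‖₂` when `‖v‖₆ ≤ m`. -/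
def forceBound (w : ℝ → E3 → ℝ) (m t : ℝ) : ℝ :=
  3 * m ^ 2 * (sixNorm w t).toReal + 3 * m * (sixNorm w t).toReal ^ 2

theorem measurable_sixNorm (hw : Measurable (Function.uncurry w)) : Measurable (sixNorm w) := by
  unfold sixNorm
  simp_rw [eLpNorm_eq_lintegral_rpow_enorm_toReal (p := 6) (by simp : (6 : ℝ≥0∞) ≠ 0) (by simp)]
  exact ((hw.enorm.pow_const _).lintegral_prod_right').pow_const _

theorem forceBound_nonneg {m : ℝ} (hm : 0 ≤ m) (t : ℝ) : 0 ≤ forceBound w m t := by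
  unfold forceBound; positivity

theorem lintegral_sixNorm_sq_lt_top (hwn : normL2L6 w < ⊤) :
    ∫⁻ t, sixNorm w t ^ (2 : ℝ) < ⊤ := by
  unfold normL2L6 at hwn
  exact (ENNReal.rpow_lt_top_iff_of_pos (by norm_num)).1 hwn

theorem ae_sixNorm_lt_top (hw : Measurable (Function.uncurry w)) (hwn : normL2L6 w < ⊤) :
    ∀ᵐ t, sixNorm w t < ⊤ := by
  filter_upwards [ae_lt_top ((measurable_sixNorm hw).pow_const _)
    (lintegral_sixNorm_sq_lt_top hwn).ne] with t ht
  exact (ENNReal.rpow_lt_top_iff_of_pos (by norm_num)).1 ht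

theorem integrable_sixNorm_sq (hw : Measurable (Function.uncurry w)) (hwn : normL2L6 w < ⊤) :
    Integrable fun t => (sixNorm w t).toReal ^ 2 := by
  have := integrable_toReal_of_lintegral_ne_top
    ((measurable_sixNorm hw).pow_const 2).aemeasurable (lintegral_sixNorm_sq_lt_top hwn).ne
  simpa [ENNReal.toReal_rpow] using this

theorem intervalIntegrable_forceBound (hw : Measurable (Function.uncurry w))
    (hwn : normL2L6 w < ⊤) (m a b : ℝ) : IntervalIntegrable (forceBound w m) volume a b := by
  have h2 : IntervalIntegrable (fun t => (sixNorm w t).toReal ^ 2) volume a b :=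
    (integrable_sixNorm_sq hw hwn).intervalIntegrable
  have h1 : IntervalIntegrable (fun t => (sixNorm w t).toReal) volume a b := by
    refine (h2.add (intervalIntegrable_const (c := (1 : ℝ)))).mono_fun
      (measurable_sixNorm hw).ennreal_toReal.aestronglyMeasurable (Eventually.of_forall fun t => ?_)
    have h0 : 0 ≤ (sixNorm w t).toReal := ENNReal.toReal_nonneg
    simp only
    rw [Real.norm_of_nonneg h0, Real.norm_of_nonneg (by positivity)]
    nlinarith [sq_nonneg ((sixNorm w t).toReal - 1)]
  exact (h1.const_mul _).add (h2.const_mul _)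

/-- The forcing term `-3 f² g - 3 f g²` is in `L²` for `f, g ∈ L⁶`. -/
theorem forcing_bound {f g : E3 → ℝ} {m : ℝ} (hm : 0 ≤ m) (hf : MemLp f 6 muOm)
    (hg : MemLp g 6 muOm) (hfm : eLpNorm f 6 muOm ≤ ENNReal.ofReal m) :
    MemLp (fun x => -3 * f x ^ 2 * g x - 3 * f x * g x ^ 2) 2 muOm ∧
      (eLpNorm (fun x => -3 * f x ^ 2 * g x - 3 * f x * g x ^ 2) 2 muOm).toReal
        ≤ 3 * m ^ 2 * (eLpNorm g 6 muOm).toReal + 3 * m * (eLpNorm g 6 muOm).toReal ^ 2 := by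
  have e : (fun x => -3 * f x ^ 2 * g x - 3 * f x * g x ^ 2)
      = ((-3 : ℝ) • fun x => f x * (f x * g x)) - ((3 : ℝ) • fun x => f x * (g x * g x)) := by
    ext x; simp only [Pi.sub_apply, Pi.smul_apply, smul_eq_mul]; ring
  have m1 := (memLp_mul_mul hf hf hg).const_smul (-3 : ℝ)
  have m2 := (memLp_mul_mul hf hg hg).const_smul (3 : ℝ)
  rw [e]
  refine ⟨m1.sub m2, ?_⟩
  set n := eLpNorm g 6 muOm with hn
  have hb : eLpNorm (((-3 : ℝ) • fun x => f x * (f x * g x))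
      - ((3 : ℝ) • fun x => f x * (g x * g x))) 2 muOm
      ≤ 3 * (ENNReal.ofReal m * (ENNReal.ofReal m * n)) + 3 * (ENNReal.ofReal m * (n * n)) := by
    refine (eLpNorm_sub_le m1.1 m2.1 (by norm_num)).trans ?_
    rw [eLpNorm_const_smul, eLpNorm_const_smul]
    have e1 : ‖(-3 : ℝ)‖ₑ = 3 := by rw [enorm_neg, Real.enorm_of_nonneg (by norm_num)]; simp
    have e2 : ‖(3 : ℝ)‖ₑ = 3 := by rw [Real.enorm_of_nonneg (by norm_num)]; simp
    rw [e1, e2]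
    gcongr
    · exact (eLpNorm_mul_mul_le hf.1 hf.1 hg.1).trans (by gcongr)
    · exact (eLpNorm_mul_mul_le hf.1 hg.1 hg.1).trans (by gcongr)
  have hnt : n ≠ ⊤ := hg.2.ne
  refine (ENNReal.toReal_mono ?_ hb).trans_eq ?_
  · simp [ENNReal.mul_eq_top, hnt]
  · rw [ENNReal.toReal_add (by simp [ENNReal.mul_eq_top, hnt])
      (by simp [ENNReal.mul_eq_top, hnt])]
    simp only [ENNReal.toReal_mul, ENNReal.toReal_ofReal hm, ENNReal.toReal_ofNat]
    ring

end Forcing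

/-! ### The weak equation over `[s, t]`, tested with the increment of the solution. -/

section Weak

variable {c₀ c₁ : ℝ → ℝ} {w : ℝ → E3 → ℝ} {T : ℝ≥0∞} {v vt : ℝ → E3 → ℝ} {gv : ℝ → E3 → E3}
  {χ : E3 → ℝ}

/-- The right-hand side of the weak formulation at time `t`. -/
def weakRhs (w v : ℝ → E3 → ℝ) (gv : ℝ → E3 → E3) (χ : E3 → ℝ) (t : ℝ) : ℝ :=
  -(∫ x, inner ℝ (gv t x) (gradient χ x) ∂muOm)
    + ∫ x, (-(v t x ^ 3) - 3 * v t x ^ 2 * w t x - 3 * v t x * w t x ^ 2) * χ x ∂muOm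

theorem IsEnergySolution.measurable_weakRhs (h : IsEnergySolution c₀ c₁ w T v vt gv)
    (hw : Measurable (Function.uncurry w)) (hχ : IsTest χ) : Measurable (weakRhs w v gv χ) := by
  have hv := h.measurable_v
  have hg := h.measurable_gv
  have hc : Measurable fun p : ℝ × E3 => χ p.2 :=
    hχ.smooth.continuous.measurable.comp measurable_snd
  have hgc : Measurable fun p : ℝ × E3 => gradient χ p.2 :=
    hχ.continuous_gradient.measurable.comp measurable_snd
  have m1 : Measurable fun t => ∫ x, inner ℝ (gv t x) (gradient χ x) ∂muOm := by
    have : Measurable (Function.uncurry fun t x => (inner ℝ (gv t x) (gradient χ x) : ℝ)) :=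
      hg.inner hgc
    exact this.stronglyMeasurable.integral_prod_right.measurable
  have m2 : Measurable fun t => ∫ x, (-(v t x ^ 3) - 3 * v t x ^ 2 * w t x
      - 3 * v t x * w t x ^ 2) * χ x ∂muOm := by
    have : Measurable (Function.uncurry fun t x => (-(v t x ^ 3) - 3 * v t x ^ 2 * w t x
      - 3 * v t x * w t x ^ 2) * χ x) :=
      ((((hv.pow_const 3).neg).sub (((hv.pow_const 2).const_mul 3).mul hw)).sub
        ((hv.const_mul 3).mul (hw.pow_const 2))).mul hc
    exact this.stronglyMeasurable.integral_prod_right.measurable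
  exact m1.neg.add m2

/-- After the gradient and cubic terms are cancelled, only the pairing of the forcing with `χ` is
left, and Cauchy–Schwarz with `forcing_bound` applies. -/
theorem IsEnergySolution.weakRhs_add_le (h : IsEnergySolution c₀ c₁ w T v vt gv)
    (hw : Measurable (Function.uncurry w)) (hχ : IsTest χ) {m t : ℝ} (hm : 0 ≤ m)
    (ht : t ∈ timeInterval T) (hvm : eLpNorm (v t) 6 muOm ≤ ENNReal.ofReal m)
    (hn : sixNorm w t < ⊤) :
    |weakRhs w v gv χ t + inner ℝ (toL2 (gv t)) (toL2 (gradient χ))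
      + inner ℝ (toL2 fun x => v t x ^ 3) (toL2 χ)| ≤ ‖toL2 χ‖ * forceBound w m t := by
  have hw6 : MemLp (w t) 6 muOm :=
    ⟨(hw.comp measurable_prodMk_left : Measurable (w t)).aestronglyMeasurable, hn⟩
  have hv6 := h.memLp_six ht
  obtain ⟨f1, f2⟩ := forcing_bound hm hv6 hw6 hvm
  have hv3 := memLp_cube hv6
  have hc := hχ.memLp 2
  have e : weakRhs w v gv χ t + inner ℝ (toL2 (gv t)) (toL2 (gradient χ))
      + inner ℝ (toL2 fun x => v t x ^ 3) (toL2 χ)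
      = inner ℝ (toL2 fun x => -3 * v t x ^ 2 * w t x - 3 * v t x * w t x ^ 2) (toL2 χ) := by
    rw [inner_toL2 (h.memLp_grad ht) (hχ.memLp_gradient 2), inner_toL2_real hv3 hc,
      inner_toL2_real f1 hc, weakRhs]
    have : ∫ x, (-(v t x ^ 3) - 3 * v t x ^ 2 * w t x - 3 * v t x * w t x ^ 2) * χ x ∂muOm
        = ∫ x, (-3 * v t x ^ 2 * w t x - 3 * v t x * w t x ^ 2) * χ x ∂muOm
          - ∫ x, v t x ^ 3 * χ x ∂muOm := by
      rw [← integral_sub (integrable_mul_of_memLp f1 hc) (integrable_mul_of_memLp hv3 hc)]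
      congr 1
      ext x
      ring
    rw [this]
    ring
  rw [e]
  refine (abs_real_inner_le_norm _ _).trans ?_
  rw [mul_comm, norm_toL2 f1]
  gcongr
  exact f2

theorem inner_intervalIntegral {H : Type*} [NormedAddCommGroup H] [InnerProductSpace ℝ H]
    [CompleteSpace H] {Y : ℝ → H} (hY : Continuous Y) (x : H) (s t : ℝ) :
    inner ℝ (∫ τ in s..t, Y τ) x = ∫ τ in s..t, inner ℝ (Y τ) x := by
  have := (innerSL ℝ x).intervalIntegral_comp_comm (hY.intervalIntegrable (μ := volume) s t)
  simp only [innerSL_apply_apply] at this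
  rw [real_inner_comm, ← this]
  simp_rw [real_inner_comm]

theorem IsEnergySolution.test_increment (h : IsEnergySolution c₀ c₁ w T v vt gv)
    (hw : Measurable (Function.uncurry w)) (hwn : normL2L6 w < ⊤) (hχ : IsTest χ) {m b : ℝ}
    (hm : 0 ≤ m) (hb : b ∈ timeInterval T)
    (hvm : ∀ t ∈ Icc 0 b, eLpNorm (v t) 6 muOm ≤ ENNReal.ofReal m)
    {Z : ℝ → Lp E3 2 muOm} {U : ℝ → Lp ℝ 2 muOm} (hZ : Continuous Z) (hU : Continuous U)
    (hZe : ∀ t ∈ Icc 0 b, Z t = toL2 (gv t)) (hUe : ∀ t ∈ Icc 0 b, U t = toL2 fun x => v t x ^ 3)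
    {s t : ℝ} (hs : 0 ≤ s) (hst : s ≤ t) (htb : t ≤ b) :
    |inner ℝ (toL2 (vt t) - toL2 (vt s)) (toL2 χ)
      + inner ℝ (∫ τ in s..t, Z τ) (toL2 (gradient χ)) + inner ℝ (∫ τ in s..t, U τ) (toL2 χ)|
      ≤ ‖toL2 χ‖ * ∫ τ in s..t, forceBound w m τ := by
  have hsub := Icc_subset_timeInterval hb
  have hgi : ∀ x y, IntervalIntegrable (fun τ => ‖toL2 χ‖ * forceBound w m τ) volume x y :=
    fun x y => (intervalIntegrable_forceBound hw hwn m x y).const_mul _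
  have hzc : Continuous fun τ => (inner ℝ (Z τ) (toL2 (gradient χ)) : ℝ) :=
    hZ.inner continuous_const
  have huc : Continuous fun τ => (inner ℝ (U τ) (toL2 χ) : ℝ) := hU.inner continuous_const
  set R : ℝ → ℝ := fun τ => weakRhs w v gv χ τ + inner ℝ (Z τ) (toL2 (gradient χ))
    + inner ℝ (U τ) (toL2 χ) with hR
  have hRb : ∀ᵐ τ, τ ∈ Icc 0 b → ‖R τ‖ ≤ ‖toL2 χ‖ * forceBound w m τ := by
    filter_upwards [ae_sixNorm_lt_top hw hwn] with τ hτ hτb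
    simp only [hR]
    rw [hZe τ hτb, hUe τ hτb]
    exact h.weakRhs_add_le hw hχ hm (hsub hτb) (hvm τ hτb) hτ
  have hRm : AEStronglyMeasurable R volume :=
    (((h.measurable_weakRhs hw hχ).add hzc.measurable).add huc.measurable).aestronglyMeasurable
  have hRi : ∀ x ∈ Icc 0 b, ∀ y ∈ Icc 0 b, IntervalIntegrable R volume x y := by
    intro x hx y hy
    refine (hgi x y).mono_fun' hRm.restrict ?_
    rw [EventuallyLE, ae_restrict_iff' measurableSet_uIoc]
    filter_upwards [hRb] with τ hτ hτm
    exact hτ (uIcc_subset_Icc hx hy (uIoc_subset_uIcc hτm))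
  -- The weak formulation does not include this integrability. It comes from the bound on `R` and
  -- the continuity of the two other terms, and it is needed to subtract the weak equations at times
  -- `t` and `s`.
  have hWi : ∀ x ∈ Icc 0 b, ∀ y ∈ Icc 0 b, IntervalIntegrable (weakRhs w v gv χ) volume x y := by
    intro x hx y hy
    have := ((hRi x hx y hy).sub (hzc.intervalIntegrable x y)).sub (huc.intervalIntegrable x y)
    refine this.congr fun τ _ => ?_
    simp only [hR]
    ring
  have h0b : (0 : ℝ) ∈ Icc 0 b := ⟨le_rfl, hb.1⟩
  have htI : t ∈ Icc 0 b := ⟨hs.trans hst, htb⟩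
  have hsI : s ∈ Icc 0 b := ⟨hs, hst.trans htb⟩
  have hc := hχ.memLp 2
  have wt := h.weak_eq χ hχ t (hsub htI)
  have ws := h.weak_eq χ hχ s (hsub hsI)
  have hdiff := intervalIntegral.integral_interval_sub_left (hWi 0 h0b t htI) (hWi 0 h0b s hsI)
  have e1 : inner ℝ (toL2 (vt t) - toL2 (vt s)) (toL2 χ) = ∫ τ in s..t, weakRhs w v gv χ τ := by
    rw [inner_sub_left, inner_toL2_real (h.memL2 t (hsub htI)) hc,
      inner_toL2_real (h.memL2 s (hsub hsI)) hc, ← hdiff]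
    simp only [weakRhs]
    rw [← wt, ← ws]
    ring
  have e2 : inner ℝ (toL2 (vt t) - toL2 (vt s)) (toL2 χ)
      + inner ℝ (∫ τ in s..t, Z τ) (toL2 (gradient χ)) + inner ℝ (∫ τ in s..t, U τ) (toL2 χ)
      = ∫ τ in s..t, R τ := by
    rw [e1, inner_intervalIntegral hZ, inner_intervalIntegral hU,
      ← intervalIntegral.integral_add (hWi s hsI t htI) (hzc.intervalIntegrable s t),
      ← intervalIntegral.integral_add ((hWi s hsI t htI).add (hzc.intervalIntegrable s t))
        (huc.intervalIntegrable s t)]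
  rw [e2, ← intervalIntegral.integral_const_mul, ← Real.norm_eq_abs]
  refine intervalIntegral.norm_integral_le_of_norm_le hst ?_ (hgi s t)
  filter_upwards [hRb] with τ hτ hτm
  exact hτ ⟨hs.trans hτm.1.le, hτm.2.trans htb⟩

/-- Both sides of `test_increment` are continuous in `χ` for the inhomogeneous `H¹` norm, so `χ` may
tend to `v t - v s`. -/
theorem IsEnergySolution.increment (h : IsEnergySolution c₀ c₁ w T v vt gv)
    (hw : Measurable (Function.uncurry w)) (hwn : normL2L6 w < ⊤) {m b : ℝ}
    (hm : 0 ≤ m) (hb : b ∈ timeInterval T)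
    (hvm : ∀ t ∈ Icc 0 b, eLpNorm (v t) 6 muOm ≤ ENNReal.ofReal m)
    {Z : ℝ → Lp E3 2 muOm} {U : ℝ → Lp ℝ 2 muOm} (hZ : Continuous Z) (hU : Continuous U)
    (hZe : ∀ t ∈ Icc 0 b, Z t = toL2 (gv t)) (hUe : ∀ t ∈ Icc 0 b, U t = toL2 fun x => v t x ^ 3)
    {s t : ℝ} (hs : 0 ≤ s) (hst : s ≤ t) (htb : t ≤ b) :
    |inner ℝ (toL2 (vt t) - toL2 (vt s)) (toL2 fun x => v t x - v s x)
      + inner ℝ (∫ τ in s..t, Z τ) (toL2 (gv t) - toL2 (gv s))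
      + inner ℝ (∫ τ in s..t, U τ) (toL2 fun x => v t x - v s x)|
      ≤ ‖toL2 fun x => v t x - v s x‖ * ∫ τ in s..t, forceBound w m τ := by
  have hsub := Icc_subset_timeInterval hb
  have htI := hsub ⟨hs.trans hst, htb⟩
  have hsI := hsub ⟨hs, hst.trans htb⟩
  have hf := h.memLp_sub hsI htI
  have hG : MemLp (fun x => gv t x - gv s x) 2 muOm := (h.memLp_grad htI).sub (h.memLp_grad hsI)
  obtain ⟨χ, hχ, l1, l2⟩ := (h.memH1D_sub hsI htI).exists_seq_test
    ((h.meas_v t).sub (h.meas_v s)) ((h.meas_gv t).sub (h.meas_gv s)) hf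
  have k1 := tendsto_toL2 (Eventually.of_forall fun n => (hχ n).memLp 2) hf l1
  have k2 := tendsto_toL2 (Eventually.of_forall fun n => (hχ n).memLp_gradient 2) hG l2
  rw [toL2_sub (h.memLp_grad htI) (h.memLp_grad hsI)] at k2
  exact le_of_tendsto_of_tendsto'
    (((tendsto_const_nhds.inner k1).add (tendsto_const_nhds.inner k2)).add
      (tendsto_const_nhds.inner k1)).abs (k1.norm.mul_const _)
    fun n => h.test_increment hw hwn (hχ n) hm hb hvm hZ hU hZe hUe hs hst htb

end Weak

/-! ### The energy inequality and its closure in terms of `E_T`. -/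

section Energy

variable {c₀ c₁ : ℝ → ℝ} {w : ℝ → E3 → ℝ} {T : ℝ≥0∞} {v vt : ℝ → E3 → ℝ} {gv : ℝ → E3 → E3}

theorem IsEnergySolution.energy_eq (h : IsEnergySolution c₀ c₁ w T v vt gv) {t : ℝ}
    (ht : t ∈ timeInterval T) (h4 : Integrable (fun x => v t x ^ 4) muOm) :
    energy v vt gv t = ENNReal.ofReal ((‖toL2 (vt t)‖ ^ 2 / 2 + ‖toL2 (gv t)‖ ^ 2 / 2)
      + ∫ x, v t x ^ 4 / 4 ∂muOm) := by
  have m1 := h.memL2 t ht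
  have m2 := h.memLp_grad ht
  have i1 : Integrable (fun x => 1 / 2 * vt t x ^ 2) muOm := by
    simpa [sq] using (integrable_mul_of_memLp m1 m1).const_mul (1 / 2)
  have i2 : Integrable (fun x => 1 / 2 * ‖gv t x‖ ^ 2) muOm := by
    simpa only [real_inner_self_eq_norm_sq] using
      (integrable_inner_of_memLp m2 m2).const_mul (1 / 2)
  have i3 : Integrable (fun x => 1 / 4 * v t x ^ 4) muOm := h4.const_mul _
  have i12 : Integrable (fun x => 1 / 2 * vt t x ^ 2 + 1 / 2 * ‖gv t x‖ ^ 2) muOm := i1.add i2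
  have i : Integrable
      (fun x => 1 / 2 * vt t x ^ 2 + 1 / 2 * ‖gv t x‖ ^ 2 + 1 / 4 * v t x ^ 4) muOm := i12.add i3
  rw [energy, ← ofReal_integral_eq_lintegral_ofReal i
    (Eventually.of_forall fun x => by simp only [Pi.zero_apply]; positivity)]
  congr 1
  rw [integral_add i12 i3, integral_add i1 i2, ← real_inner_self_eq_norm_sq,
    ← real_inner_self_eq_norm_sq, inner_toL2_real m1 m1, inner_toL2 m2 m2, integral_const_mul,
    integral_const_mul, integral_const_mul, integral_div]
  simp only [real_inner_self_eq_norm_sq, ← sq]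
  ring

theorem IsEnergySolution.integrable_pow_four_zero (h : IsEnergySolution c₀ c₁ w T v vt gv)
    (h0 : energy v vt gv 0 < ⊤) : Integrable (fun x => v 0 x ^ 4) muOm := by
  have hm : Measurable fun x => 1 / 4 * v 0 x ^ 4 := ((h.meas_v 0).pow_const 4).const_mul _
  have h1 : Integrable (fun x => 1 / 4 * v 0 x ^ 4) muOm := by
    refine ⟨hm.aestronglyMeasurable, lt_of_le_of_lt (lintegral_mono fun x => ?_) h0⟩
    rw [Real.enorm_of_nonneg (by positivity)]
    exact ENNReal.ofReal_le_ofReal (le_add_of_nonneg_left (by positivity))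
  refine (h1.const_mul 4).congr (Eventually.of_forall fun x => ?_)
  simp only
  ring

theorem IsEnergySolution.integrable_pow_four (h : IsEnergySolution c₀ c₁ w T v vt gv)
    (h0 : energy v vt gv 0 < ⊤) {t : ℝ} (ht : t ∈ timeInterval T) :
    Integrable (fun x => v t x ^ 4) muOm :=
  integrable_pow_four_of_sub (h.meas_v t) (h.memLp_six ht)
    (h.memLp_sub ⟨le_rfl, by simpa using h.pos⟩ ht) (h.integrable_pow_four_zero h0)

/-- The subgradient inequality for the potential energy `¼ ∫ v⁴`. -/
theorem IsEnergySolution.inner_cube_le (h : IsEnergySolution c₀ c₁ w T v vt gv)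
    (h0 : energy v vt gv 0 < ⊤) {s t : ℝ} (hs : s ∈ timeInterval T) (ht : t ∈ timeInterval T) :
    inner ℝ (toL2 fun x => v s x ^ 3) (toL2 fun x => v t x - v s x)
      ≤ (∫ x, v t x ^ 4 / 4 ∂muOm) - ∫ x, v s x ^ 4 / 4 ∂muOm := by
  have i1 := (h.integrable_pow_four h0 ht).div_const 4
  have i2 := (h.integrable_pow_four h0 hs).div_const 4
  have m1 := memLp_cube (h.memLp_six hs)
  have m2 := h.memLp_sub hs ht
  rw [inner_toL2_real m1 m2, ← integral_sub i1 i2]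
  exact integral_mono (integrable_mul_of_memLp m1 m2) (i1.sub i2)
    fun x => cube_mul_sub_le (v t x) (v s x)

theorem IsEnergySolution.continuous_vt_clamp (h : IsEnergySolution c₀ c₁ w T v vt gv) {b : ℝ}
    (hb : b ∈ timeInterval T) : Continuous fun t => toL2 (vt (clamp b t)) :=
  continuous_toL2_clamp hb.1 (Icc_subset_timeInterval hb) h.memL2 h.continuous_L2

theorem IsEnergySolution.continuous_gv_clamp (h : IsEnergySolution c₀ c₁ w T v vt gv) {b : ℝ}
    (hb : b ∈ timeInterval T) : Continuous fun t => toL2 (gv (clamp b t)) :=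
  continuous_toL2_clamp hb.1 (Icc_subset_timeInterval hb) (fun _ ht => h.memLp_grad ht)
    h.continuous_H1

/-- The bound `M` is left free: it is taken from compactness of `[0, b]` when `w` vanishes, and from
`E_T` when that is finite. -/
theorem IsEnergySolution.energy_le (h : IsEnergySolution c₀ c₁ w T v vt gv)
    (hw : Measurable (Function.uncurry w)) (hwn : normL2L6 w < ⊤) (h0 : energy v vt gv 0 < ⊤)
    {M t b : ℝ} (hM0 : 0 ≤ M) (ht : 0 ≤ t) (htb : t < b) (hb : b ∈ timeInterval T)
    (hMt : ∀ τ ∈ Icc 0 b, eLpNorm (vt τ) 2 muOm ≤ ENNReal.ofReal M)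
    (hMx : ∀ τ ∈ Icc 0 b, eLpNorm (gv τ) 2 muOm ≤ ENNReal.ofReal M) :
    energy v vt gv t ≤ energy v vt gv 0
      + ENNReal.ofReal (M * ∫ τ in (0 : ℝ)..b, forceBound w (sobolevConst * M) τ) := by
  have hsub := Icc_subset_timeInterval hb
  have h0I : (0 : ℝ) ∈ Icc 0 b := ⟨le_rfl, hb.1⟩
  have htI : t ∈ Icc 0 b := ⟨ht, htb.le⟩
  have hm : 0 ≤ sobolevConst * M := by positivity
  have hvm : ∀ τ ∈ Icc 0 b, eLpNorm (v τ) 6 muOm ≤ ENNReal.ofReal (sobolevConst * M) := by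
    intro τ hτ
    rw [ENNReal.ofReal_mul (by positivity), ENNReal.ofReal_coe_nnreal]
    refine ((h.memH1 τ (hsub hτ)).eLpNorm_six_le (h.meas_v τ) (h.meas_gv τ)).trans ?_
    gcongr
    exact hMx τ hτ
  have hYc := h.continuous_vt_clamp hb
  have hZc := h.continuous_gv_clamp hb
  have hUc : Continuous fun t => toL2 fun x => v (clamp b t) x ^ 3 :=
    continuous_toL2_clamp (u := fun t x => v t x ^ 3) hb.1 hsub
      (fun τ hτ => memLp_cube (h.memLp_six hτ))
      (fun τ hτ => tendsto_eLpNorm_cube h.meas_v (h.meas_v τ) (h.memLp_six hτ) (h.tendsto_six hτ))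
  set Y : ℝ → Lp ℝ 2 muOm := fun t => toL2 (vt (clamp b t)) with hY
  set Z : ℝ → Lp E3 2 muOm := fun t => toL2 (gv (clamp b t)) with hZ
  set U : ℝ → Lp ℝ 2 muOm := fun t => toL2 fun x => v (clamp b t) x ^ 3 with hU
  have hYe : ∀ τ ∈ Icc 0 b, Y τ = toL2 (vt τ) := fun τ hτ => by simp only [hY, clamp_eq hτ]
  have hZe : ∀ τ ∈ Icc 0 b, Z τ = toL2 (gv τ) := fun τ hτ => by simp only [hZ, clamp_eq hτ]
  have hUe : ∀ τ ∈ Icc 0 b, U τ = toL2 fun x => v τ x ^ 3 := fun τ hτ => by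
    simp only [hU, clamp_eq hτ]
  have hX : ∀ τ ∈ Icc 0 b, HasDerivWithinAt (fun t => toL2 fun x => v t x - v 0 x) (Y τ)
      (Icc 0 b) τ := fun τ hτ => h.hasDerivWithinAt hb hτ
  have hXsub : ∀ s ∈ Icc 0 b, ∀ τ ∈ Icc 0 b, (toL2 fun x => v τ x - v 0 x)
      - (toL2 fun x => v s x - v 0 x) = toL2 fun x => v τ x - v s x := by
    intro s hs τ hτ
    rw [← toL2_sub (h.memLp_sub (hsub h0I) (hsub hτ)) (h.memLp_sub (hsub h0I) (hsub hs))]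
    simp only [sub_sub_sub_cancel_right]
  have hYM : ∀ τ ∈ Icc 0 b, ‖Y τ‖ ≤ M := by
    intro τ hτ
    rw [hYe τ hτ, norm_toL2 (h.memL2 τ (hsub hτ))]
    exact ENNReal.toReal_le_of_le_ofReal hM0 (hMt τ hτ)
  have key := energy_estimate_of_increments hYc hUc hZc
    (fun x y => intervalIntegrable_forceBound hw hwn (sobolevConst * M) x y)
    (fun τ => forceBound_nonneg hm τ) hYM ?_ ht htb
  -- The time integral of `⟨v³, ∂_t v⟩` becomes the change of the potential energy, which completes
  -- the kinetic and gradient parts to `E(v)`.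
  · have hpot := sub_eq_integral_of_subgradient (ψ := fun t => ∫ x, v t x ^ 4 / 4 ∂muOm) ht
      (fun τ hτ => (hX τ ⟨hτ.1, hτ.2.trans htb.le⟩).mono (Icc_subset_Icc_right htb.le)) hYc hUc
      (fun s hs τ hτ => by
        have hs' : s ∈ Icc 0 b := ⟨hs.1, hs.2.trans htb.le⟩
        have hτ' : τ ∈ Icc 0 b := ⟨hτ.1, hτ.2.trans htb.le⟩
        rw [hXsub s hs' τ hτ', hUe s hs']
        exact h.inner_cube_le h0 (hsub hs') (hsub hτ'))
    rw [hpot, hYe t htI, hZe t htI, hYe 0 h0I, hZe 0 h0I] at key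
    rw [h.energy_eq (hsub htI) (h.integrable_pow_four h0 (hsub htI)),
      h.energy_eq (hsub h0I) (h.integrable_pow_four h0 (hsub h0I))]
    have hψ0 : 0 ≤ ∫ x, v 0 x ^ 4 / 4 ∂muOm := integral_nonneg fun x => by positivity
    have hg0 : 0 ≤ ∫ τ in (0 : ℝ)..b, forceBound w (sobolevConst * M) τ :=
      intervalIntegral.integral_nonneg hb.1 fun τ _ => forceBound_nonneg hm τ
    rw [← ENNReal.ofReal_add (by positivity) (by positivity)]
    refine ENNReal.ofReal_le_ofReal ?_
    have := (abs_le.1 key).2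
    linarith
  · intro s τ hs hsτ hτb
    have hsI : s ∈ Icc 0 b := ⟨hs, hsτ.le.trans hτb⟩
    have hτI : τ ∈ Icc 0 b := ⟨hs.trans hsτ.le, hτb⟩
    rw [integral_eq_sub_of_hasDerivWithinAt_Icc hX hYc hs hsτ.le hτb, hXsub s hsI τ hτI,
      hYe s hsI, hYe τ hτI, hZe s hsI, hZe τ hτI]
    exact h.increment hw hwn hm hb hvm hZc hUc hZe hUe hs hsτ.le hτb

/-- Cauchy–Schwarz in time against the constant `1`; this is the source of the factor `T^{1/2}`. -/
theorem lintegral_sixNorm_le (hw : Measurable (Function.uncurry w)) (b : ℝ) :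
    ∫⁻ t in Ioc 0 b, sixNorm w t ≤ ENNReal.ofReal b ^ (1 / 2 : ℝ) * normL2L6 w := by
  have h1 := ENNReal.lintegral_mul_le_Lp_mul_Lq (volume.restrict (Ioc 0 b))
    Real.HolderConjugate.two_two (f := sixNorm w) (g := fun _ => 1)
    (measurable_sixNorm hw).aemeasurable aemeasurable_const
  simp only [Pi.mul_apply, mul_one, ENNReal.one_rpow, lintegral_const, one_mul,
    Measure.restrict_apply MeasurableSet.univ, univ_inter, Real.volume_Ioc, sub_zero] at h1
  rw [mul_comm]
  refine h1.trans ?_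
  gcongr
  unfold normL2L6
  gcongr
  · exact Measure.restrict_le_self
  · exact le_rfl

theorem ofReal_integral_forceBound_le (hw : Measurable (Function.uncurry w))
    (hwn : normL2L6 w < ⊤) {m b : ℝ} (hm : 0 ≤ m) (hb : 0 ≤ b) :
    ENNReal.ofReal (∫ τ in (0 : ℝ)..b, forceBound w m τ) ≤
      3 * ENNReal.ofReal m ^ 2 * (ENNReal.ofReal b ^ (1 / 2 : ℝ) * normL2L6 w)
        + 3 * ENNReal.ofReal m * normL2L6 w ^ (2 : ℝ) := by
  have hN := measurable_sixNorm hw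
  have hsq : ∫⁻ t in Ioc 0 b, sixNorm w t ^ 2 ≤ normL2L6 w ^ (2 : ℝ) := by
    rw [normL2L6, ← ENNReal.rpow_mul]
    norm_num
    exact setLIntegral_le_lintegral _ _
  rw [intervalIntegral.integral_of_le hb, ofReal_integral_eq_lintegral_ofReal
    (intervalIntegrable_forceBound hw hwn m 0 b).1
    (Eventually.of_forall fun t => forceBound_nonneg hm t)]
  calc ∫⁻ t in Ioc 0 b, ENNReal.ofReal (forceBound w m t)
      ≤ ∫⁻ t in Ioc 0 b, (3 * ENNReal.ofReal m ^ 2 * sixNorm w t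
          + 3 * ENNReal.ofReal m * sixNorm w t ^ 2) := by
        refine lintegral_mono fun t => ?_
        rw [forceBound, ENNReal.ofReal_add (by positivity) (by positivity),
          ENNReal.ofReal_mul (by positivity), ENNReal.ofReal_mul (by positivity),
          ENNReal.ofReal_mul (by positivity), ENNReal.ofReal_mul (by positivity),
          ENNReal.ofReal_pow hm, ENNReal.ofReal_pow ENNReal.toReal_nonneg, ENNReal.ofReal_ofNat]
        gcongr <;> exact ENNReal.ofReal_toReal_le
    _ = 3 * ENNReal.ofReal m ^ 2 * (∫⁻ t in Ioc 0 b, sixNorm w t)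
          + 3 * ENNReal.ofReal m * ∫⁻ t in Ioc 0 b, sixNorm w t ^ 2 := by
        rw [lintegral_add_left (hN.const_mul _), lintegral_const_mul _ hN,
          lintegral_const_mul _ (hN.pow_const 2)]
    _ ≤ _ := by
        gcongr
        exact lintegral_sixNorm_le hw b

/-- Serves both `u = ∂_t v` and `u = ∇v`. The sharp constant `√2` is rounded up to `2`. -/
theorem eLpNorm_two_le_energy {F : Type*} [NormedAddCommGroup F] {u : E3 → F} {t : ℝ}
    (hu : ∀ x, 1 / 2 * ‖u x‖ ^ 2 ≤ 1 / 2 * vt t x ^ 2 + 1 / 2 * ‖gv t x‖ ^ 2 + 1 / 4 * v t x ^ 4) :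
    eLpNorm u 2 muOm ≤ 2 * energy v vt gv t ^ (1 / 2 : ℝ) := by
  rw [eLpNorm_eq_lintegral_rpow_enorm_toReal (by simp) (by simp)]
  have h1 : ∫⁻ x, ‖u x‖ₑ ^ (2 : ℝ≥0∞).toReal ∂muOm ≤ 2 * energy v vt gv t := by
    rw [energy, ← lintegral_const_mul' _ _ (by simp)]
    refine lintegral_mono fun x => ?_
    rw [← ofReal_norm, ENNReal.toReal_ofNat, ENNReal.rpow_ofNat,
      ← ENNReal.ofReal_pow (norm_nonneg _)]
    refine (ENNReal.ofReal_le_ofReal (by linarith [hu x] : _ ≤ 2 *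
      (1 / 2 * vt t x ^ 2 + 1 / 2 * ‖gv t x‖ ^ 2 + 1 / 4 * v t x ^ 4))).trans_eq ?_
    rw [ENNReal.ofReal_mul (by norm_num), ENNReal.ofReal_ofNat]
  rw [ENNReal.toReal_ofNat]
  refine (ENNReal.rpow_le_rpow h1 (by norm_num)).trans ?_
  rw [ENNReal.mul_rpow_of_nonneg _ _ (by norm_num)]
  gcongr
  calc (2 : ℝ≥0∞) ^ (1 / 2 : ℝ) ≤ 2 ^ (1 : ℝ) :=
        ENNReal.rpow_le_rpow_of_exponent_le (by norm_num) (by norm_num)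
    _ = 2 := ENNReal.rpow_one _

theorem IsEnergySolution.exists_kinetic_bound (h : IsEnergySolution c₀ c₁ w T v vt gv) {b : ℝ}
    (hb : b ∈ timeInterval T) :
    ∃ M : ℝ, 0 ≤ M ∧ (∀ τ ∈ Icc 0 b, eLpNorm (vt τ) 2 muOm ≤ ENNReal.ofReal M) ∧
      ∀ τ ∈ Icc 0 b, eLpNorm (gv τ) 2 muOm ≤ ENNReal.ofReal M := by
  have hsub := Icc_subset_timeInterval hb
  obtain ⟨M₁, h1⟩ := isCompact_Icc.exists_bound_of_continuousOn (s := Icc (0 : ℝ) b)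
    (h.continuous_vt_clamp hb).continuousOn
  obtain ⟨M₂, h2⟩ := isCompact_Icc.exists_bound_of_continuousOn (s := Icc (0 : ℝ) b)
    (h.continuous_gv_clamp hb).continuousOn
  refine ⟨max M₁ M₂, (norm_nonneg _).trans ((h1 0 ⟨le_rfl, hb.1⟩).trans (le_max_left _ _)),
    fun τ hτ => ?_, fun τ hτ => ?_⟩
  · have m := h.memL2 τ (hsub hτ)
    have := h1 τ hτ
    rw [clamp_eq hτ, norm_toL2 m] at this
    rw [← ENNReal.ofReal_toReal m.2.ne]
    exact ENNReal.ofReal_le_ofReal (this.trans (le_max_left _ _))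
  · have m := h.memLp_grad (hsub hτ)
    have := h2 τ hτ
    rw [clamp_eq hτ, norm_toL2 m] at this
    rw [← ENNReal.ofReal_toReal m.2.ne]
    exact ENNReal.ofReal_le_ofReal (this.trans (le_max_right _ _))

/-- If `w` vanishes, the energy does not increase. -/
theorem IsEnergySolution.energySup_le_of_normL2L6_eq_zero
    (h : IsEnergySolution c₀ c₁ w T v vt gv) (hw : Measurable (Function.uncurry w))
    (hwn : normL2L6 w = 0) (h0 : energy v vt gv 0 < ⊤) :
    energySup T v vt gv ≤ energy v vt gv 0 := by
  refine iSup₂_le fun t ht => ?_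
  obtain ⟨b, htb, hb⟩ := exists_gt_mem_timeInterval ht
  obtain ⟨M, hM0, hM1, hM2⟩ := h.exists_kinetic_bound hb
  have hlt : normL2L6 w < ⊤ := hwn ▸ ENNReal.zero_lt_top
  have h1 := h.energy_le hw hlt h0 hM0 ht.1 htb hb hM1 hM2
  have h2 := ofReal_integral_forceBound_le hw hlt
    (by positivity : 0 ≤ sobolevConst * M) hb.1
  rw [hwn, ENNReal.zero_rpow_of_pos two_pos] at h2
  simp only [mul_zero, add_zero, nonpos_iff_eq_zero] at h2
  rw [ENNReal.ofReal_mul hM0, h2, mul_zero, add_zero] at h1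
  exact h1

theorem IsEnergySolution.energySup_le_of_lt_top (h : IsEnergySolution c₀ c₁ w T v vt gv)
    (hw : Measurable (Function.uncurry w)) (hwn : normL2L6 w < ⊤)
    (hE : energySup T v vt gv < ⊤) :
    energySup T v vt gv ≤ energy v vt gv 0
      + 24 * (sobolevConst : ℝ≥0∞) ^ 2
        * (energySup T v vt gv ^ (3 / 2 : ℝ) * T ^ (1 / 2 : ℝ) * normL2L6 w)
      + 12 * (sobolevConst : ℝ≥0∞) * (energySup T v vt gv * normL2L6 w ^ (2 : ℝ)) := by
  have hle : ∀ t ∈ timeInterval T, energy v vt gv t ≤ energySup T v vt gv := fun t ht =>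
    le_iSup₂ (f := fun t (_ : t ∈ timeInterval T) => energy v vt gv t) t ht
  set E := energySup T v vt gv with hEdef
  have h0 : energy v vt gv 0 < ⊤ :=
    (hle 0 ⟨le_rfl, by simpa using h.pos⟩).trans_lt hE
  -- `A` bounds `‖∂_t v‖₂` and `‖∇v‖₂` at all times. The forcing contributes `3S²A³` and `3SA²`; as
  -- `A³ = 8E^{3/2}` and `A² = 4E`, the constants are `24S²` and `12S`.
  set A : ℝ≥0∞ := 2 * E ^ (1 / 2 : ℝ) with hA
  have hAt : A ≠ ⊤ := ENNReal.mul_ne_top (by simp)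
    (ENNReal.rpow_ne_top_of_nonneg (by norm_num) hE.ne)
  have hA2 : A * A = 4 * E := by
    have : E ^ (1 / 2 : ℝ) * E ^ (1 / 2 : ℝ) = E := by
      rw [← ENNReal.rpow_add_of_nonneg _ _ (by norm_num) (by norm_num)]; norm_num
    calc A * A = 4 * (E ^ (1 / 2 : ℝ) * E ^ (1 / 2 : ℝ)) := by rw [hA]; ring
      _ = 4 * E := by rw [this]
  have hA3 : A * A * A = 8 * E ^ (3 / 2 : ℝ) := by
    have : E * E ^ (1 / 2 : ℝ) = E ^ (3 / 2 : ℝ) := by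
      nth_rw 1 [← ENNReal.rpow_one E]
      rw [← ENNReal.rpow_add_of_nonneg _ _ (by norm_num) (by norm_num)]; norm_num
    rw [hA2, ← this, hA]; ring
  refine iSup₂_le fun t ht => ?_
  obtain ⟨b, htb, hb⟩ := exists_gt_mem_timeInterval ht
  have hsub := Icc_subset_timeInterval hb
  have hbound : ∀ τ ∈ Icc 0 b, 2 * energy v vt gv τ ^ (1 / 2 : ℝ) ≤ A := fun τ hτ => by
    rw [hA]
    gcongr
    exact hle τ (hsub hτ)
  have h1 := h.energy_le hw hwn h0 (M := A.toReal) ENNReal.toReal_nonneg ht.1 htb hb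
    (fun τ hτ => by
      rw [ENNReal.ofReal_toReal hAt]
      refine (eLpNorm_two_le_energy fun x => ?_).trans (hbound τ hτ)
      rw [Real.norm_eq_abs, sq_abs, add_assoc]
      exact le_add_of_nonneg_right (by positivity))
    (fun τ hτ => by
      rw [ENNReal.ofReal_toReal hAt]
      refine (eLpNorm_two_le_energy fun x => ?_).trans (hbound τ hτ)
      have : 0 ≤ vt τ x ^ 2 := sq_nonneg _
      have : 0 ≤ v τ x ^ 4 := by positivity
      linarith)
  have h2 := ofReal_integral_forceBound_le hw hwn
    (by positivity : 0 ≤ sobolevConst * A.toReal) hb.1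
  rw [ENNReal.ofReal_mul (by positivity), ENNReal.ofReal_coe_nnreal,
    ENNReal.ofReal_toReal hAt] at h2
  rw [ENNReal.ofReal_mul ENNReal.toReal_nonneg, ENNReal.ofReal_toReal hAt] at h1
  have hbT : ENNReal.ofReal b ≤ T := hb.2.le
  calc energy v vt gv t ≤ _ := h1
    _ ≤ energy v vt gv 0 + A * (3 * (sobolevConst * A) ^ 2 * (T ^ (1 / 2 : ℝ) * normL2L6 w)
          + 3 * (sobolevConst * A) * normL2L6 w ^ (2 : ℝ)) := by
        gcongr
        exact h2.trans (by gcongr)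
    _ = energy v vt gv 0 + (3 * (sobolevConst : ℝ≥0∞) ^ 2 * (A * A * A)
          * (T ^ (1 / 2 : ℝ) * normL2L6 w)
          + 3 * sobolevConst * (A * A) * normL2L6 w ^ (2 : ℝ)) := by ring
    _ = _ := by rw [hA3, hA2]; ring

theorem IsEnergySolution.energySup_le (h : IsEnergySolution c₀ c₁ w T v vt gv)
    (hw : Measurable (Function.uncurry w)) :
    energySup T v vt gv ≤ (1 + 24 * sobolevConst ^ 2 + 12 * sobolevConst : ℝ≥0) *
      (energy v vt gv 0
        + energySup T v vt gv ^ (3 / 2 : ℝ) * T ^ (1 / 2 : ℝ) * normL2L6 w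
        + energySup T v vt gv * normL2L6 w ^ (2 : ℝ)) := by
  set C : ℝ≥0 := 1 + 24 * sobolevConst ^ 2 + 12 * sobolevConst with hC
  have hC1 : (1 : ℝ≥0∞) ≤ C := by
    rw [hC]; exact_mod_cast (le_add_right (le_add_right le_rfl))
  have hself : ∀ x : ℝ≥0∞, x ≤ C * x := fun x => le_mul_of_one_le_left' hC1
  rcases eq_or_ne (energySup T v vt gv) 0 with hE0 | hE0
  · rw [hE0]; exact zero_le
  rcases eq_or_ne (energy v vt gv 0) ⊤ with h0 | h0
  · refine le_trans ?_ (hself _)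
    rw [h0]; simp
  -- Here `E_T = ∞` is not yet excluded and the terms with `w` are `0` by the convention `0 · ∞ =
  -- 0`, so a separate argument independent of `E_T` is required.
  rcases eq_or_ne (normL2L6 w) 0 with hw0 | hw0
  · refine (h.energySup_le_of_normL2L6_eq_zero hw hw0 h0.lt_top).trans (le_trans ?_ (hself _))
    rw [add_assoc]
    exact le_self_add
  have hsq0 : normL2L6 w ^ (2 : ℝ) ≠ 0 := by simp [hw0]
  rcases eq_or_ne (normL2L6 w) ⊤ with hwt | hwt
  · refine le_trans ?_ (hself _)
    have : normL2L6 w ^ (2 : ℝ) = ⊤ := by rw [hwt]; exact ENNReal.top_rpow_of_pos two_pos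
    rw [this, ENNReal.mul_top hE0, add_top]
    exact le_top
  -- If `E_T = ∞` and `w` has nonzero norm, the last term on the right is already infinite.
  rcases eq_or_ne (energySup T v vt gv) ⊤ with hEt | hEt
  · refine le_trans ?_ (hself _)
    rw [hEt, ENNReal.top_mul hsq0, add_top]
  refine (h.energySup_le_of_lt_top hw hwt.lt_top hEt.lt_top).trans ?_
  rw [mul_add, mul_add]
  have e : (C : ℝ≥0∞) = 1 + 24 * (sobolevConst : ℝ≥0∞) ^ 2 + 12 * sobolevConst := by
    rw [hC]; push_cast; rfl
  refine add_le_add (add_le_add (hself _) ?_) ?_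
  · refine mul_le_mul_left ?_ _
    rw [e, add_right_comm]; exact le_add_self
  · refine mul_le_mul_left ?_ _
    rw [e]; exact le_add_self

end Energy

end ExteriorNLW

end

theorem proposition4p3 :
    ∃ C : ℝ≥0, ∀ (φ : ℝ → ℝ), ExteriorNLW.IsCutoff φ →
      ∀ (s : ℝ), 1 / 2 < s → s ≤ 1 →
      ∀ (u₀ : ExteriorNLW.E3 → ℝ) (a₀ a₁ : ℝ → ℝ), ExteriorNLW.IsData s u₀ a₀ a₁ →
      ∀ (J : ℝ) (w : ℝ → ExteriorNLW.E3 → ℝ),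
        ExteriorNLW.IsGlobalSolution (ExteriorNLW.highFreq φ (2 ^ J) a₀)
          (ExteriorNLW.highFreq φ (2 ^ J) a₁) w →
      ∀ (T : ℝ≥0∞) (v vt : ℝ → ExteriorNLW.E3 → ℝ)
        (gv : ℝ → ExteriorNLW.E3 → ExteriorNLW.E3),
        ExteriorNLW.IsEnergySolution (ExteriorNLW.lowFreq φ (2 ^ J) a₀)
          (ExteriorNLW.lowFreq φ (2 ^ J) a₁) w T v vt gv →
      (∀ t ∈ ExteriorNLW.timeInterval T,
        ExteriorNLW.energy v vt gv t ≤ ExteriorNLW.energySup T v vt gv) ∧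
      ExteriorNLW.energySup T v vt gv ≤
        C * (ExteriorNLW.energy v vt gv 0
          + ExteriorNLW.energySup T v vt gv ^ (3 / 2 : ℝ) * T ^ (1 / 2 : ℝ)
              * ExteriorNLW.normL2L6 w
          + ExteriorNLW.energySup T v vt gv * ExteriorNLW.normL2L6 w ^ (2 : ℝ)) := by
  refine ⟨1 + 24 * ExteriorNLW.sobolevConst ^ 2 + 12 * ExteriorNLW.sobolevConst, ?_⟩
  intro φ _ s _ _ u₀ a₀ a₁ _ J w hw T v vt gv hv
  exact ⟨fun t ht => le_iSup₂ (f := fun t (_ : t ∈ ExteriorNLW.timeInterval T) =>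
    ExteriorNLW.energy v vt gv t) t ht, hv.energySup_le hw.measurable⟩
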